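/- All manifolds are smooth, Hausdorff, second countable and without boundary. Let $\dim M=4n$. An almost quaternionic skew-Hermitian structure (an $SO^*(2n)Sp(1)$-structure) on $M$ is a pair $(Q,\omega)$, where $Q\subset\mathrm{End}(TM)$ is an almost quaternionic structure, i.e. a subbundle locally spanned by a smooth admissible basis $(J_1,J_2,J_3)$ with $J_a^2=-\mathrm{id}$ and $J_1J_2=J_3=-J_2J_1$, and $\omega$ is a smooth non-degenerate 2-form which is $Q$-Hermitian, i.e. $\omega(J_aX,J_aY)=\omega(X,Y)$ for every local admissible basis. It is torsion-free (and $(M,Q,\omega)$ is then called a qs-H manifold) if some smooth torsion-free connection preserves $Q$ and $\omega$. For a volume form $\mathrm{vol}$, the unimodular Oproiu connection $\nabla^{Q,\mathrm{vol}}$ is the smooth connection preserving $Q$ and $\mathrm{vol}$ whose torsion is, for every local admissible basis, $$T^H+\sum_{a=1}^3\partial(\tau_a\otimes J_a),\qquad T^H=\tfrac16\sum_{a=1}^3 N_{J_a},\qquad \tau_a(X)=\tfrac1{4n-2}\,\mathrm{tr}(J_a\circ T^H_X),$$ where $N_J(X,Y)=[JX,JY]-J[JX,Y]-J[X,JY]-[X,Y]$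 is the Nijenhuis tensor, $T^H_X=T^H(X,\cdot)$, and $\partial(\tau\otimes J)(X,Y)=\tau(X)JY-\tau(Y)JX$. With $\mathrm{vol}=\omega^{2n}$, the minimal adapted connection of $(Q,\omega)$ is $\nabla^{Q,\omega}=\nabla^{Q,\mathrm{vol}}+A$, where $\omega(A(X,Y),Z)=\tfrac12(\nabla^{Q,\mathrm{vol}}_X\omega)(Y,Z)$. Theorem. Let $1\le k<n$, let $(M^{4n},Q,\omega)$ be a qs-H manifold, and let $\iota:N^{4k}\to M^{4n}$ be a smooth immersion that makes $N$ an almost quaternionic submanifold: $J(\iota_*T_xN)\subseteq\iota_*T_xN$ for all $x\in N$ and $J\in Q_{\iota(x)}$. Put $\hat Q=Q|_{TN}$ and $\hat\omega=\iota^*\omega$, and assume that $\hat\omega$ is non-degenerate. Then $(\hat Q,\hat\omega)$ is a torsion-free $SO^*(2k)Sp(1)$-structure on $N$, so that $(N,\hat Q,\hat\omega)$ is itself a qs-H manifold, and $\hat\omega$ is closed, hence symplectic. Moreover, the connections $\nabla^{Q,\omega}$ and $\nabla^{Q,\mathrm{vol}}$ (with $\mathrm{vol}=\omega^{2n}$)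 on $M$ and the minimal adapted connection $\nabla^{\hat Q,\hat\omega}$ on $N$ exist and are unique, $\nabla^{Q,\omega}$ and $\nabla^{\hat Q,\hat\omega}$ are torsion-free, and $$\nabla^{\hat Q,\hat\omega}=\nabla^{Q,\omega}|_{TN}=\nabla^{Q,\mathrm{vol}}|_{TN},$$ which means that $\iota_*(\nabla^{\hat Q,\hat\omega}_vY')=\nabla_{\iota_*v}Y$ for $\nabla=\nabla^{Q,\omega}$ and for $\nabla=\nabla^{Q,\mathrm{vol}}$, for all $x\in N$ and $v\in T_xN$, whenever a vector field $Y$ on $M$ extends a vector field $Y'$ on $N$ near $x$, i.e. $\iota_*Y'=Y\circ\iota$ near $x$. -/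

import Mathlib

open Set Topology
open scoped Manifold ContDiff Bundle

noncomputable section

namespace QSH

section Structures

variable (n : ℕ) {M : Type*} [TopologicalSpace M] [ChartedSpace (EuclideanSpace ℝ (Fin (4 * n))) M]
  [IsManifold (𝓡 (4 * n)) ∞ M]

/-- Fields of endomorphisms of the tangent bundle of a `4n`-dimensional manifold. -/
abbrev EndField (M : Type*) [TopologicalSpace M]
    [ChartedSpace (EuclideanSpace ℝ (Fin (4 * n))) M] : Type _ :=
  Π x : M, TangentSpace (𝓡 (4 * n)) x →L[ℝ] TangentSpace (𝓡 (4 * n)) x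

/-- Fields of bilinear forms on the tangent spaces. -/
abbrev FormField (M : Type*) [TopologicalSpace M]
    [ChartedSpace (EuclideanSpace ℝ (Fin (4 * n))) M] : Type _ :=
  Π x : M, TangentSpace (𝓡 (4 * n)) x →L[ℝ] TangentSpace (𝓡 (4 * n)) x →L[ℝ] ℝ

/-- Fields `x ↦ Q_x` of linear subspaces of the endomorphisms of the tangent spaces. -/
abbrev EndSubspaceField (M : Type*) [TopologicalSpace M]
    [ChartedSpace (EuclideanSpace ℝ (Fin (4 * n))) M] : Type _ :=
  Π x : M, Submodule ℝ (TangentSpace (𝓡 (4 * n)) x →L[ℝ] TangentSpace (𝓡 (4 * n)) x)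

/-- Vector fields, with no regularity imposed. -/
abbrev VField (M : Type*) [TopologicalSpace M]
    [ChartedSpace (EuclideanSpace ℝ (Fin (4 * n))) M] : Type _ :=
  Π x : M, TangentSpace (𝓡 (4 * n)) x

/-- Affine connections, i.e. covariant derivatives on the tangent bundle; `∇ Y x v` is the
vector `(∇_v Y)(x)`. -/
abbrev Conn (M : Type*) [TopologicalSpace M] [ChartedSpace (EuclideanSpace ℝ (Fin (4 * n))) M]
    [IsManifold (𝓡 (4 * n)) ∞ M] : Type _ :=
  CovariantDerivative (𝓡 (4 * n)) (EuclideanSpace ℝ (Fin (4 * n)))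
    (TangentSpace (𝓡 (4 * n)) : M → Type _)

/-- The vector field `X` is differentiable at `x`. -/
def DiffAt (X : VField n M) (x : M) : Prop :=
  MDifferentiableAt (𝓡 (4 * n)) ((𝓡 (4 * n)).prod 𝓘(ℝ, EuclideanSpace ℝ (Fin (4 * n))))
    (fun y ↦ Bundle.TotalSpace.mk' (EuclideanSpace ℝ (Fin (4 * n))) y (X y)) x

/-- The field of endomorphisms `σ` is smooth on the set `U`. -/
def SmoothEndOn (σ : EndField n M) (U : Set M) : Prop :=
  ContMDiffOn (𝓡 (4 * n))
    ((𝓡 (4 * n)).prod 𝓘(ℝ, EuclideanSpace ℝ (Fin (4 * n)) →L[ℝ] EuclideanSpace ℝ (Fin (4 * n)))) ∞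
    (fun x ↦ Bundle.TotalSpace.mk'
      (EuclideanSpace ℝ (Fin (4 * n)) →L[ℝ] EuclideanSpace ℝ (Fin (4 * n))) x (σ x)) U

/-- The field of bilinear forms `θ` is smooth. -/
def SmoothForm (θ : FormField n M) : Prop :=
  ContMDiff (𝓡 (4 * n))
    ((𝓡 (4 * n)).prod
      𝓘(ℝ, EuclideanSpace ℝ (Fin (4 * n)) →L[ℝ] EuclideanSpace ℝ (Fin (4 * n)) →L[ℝ] ℝ)) ∞
    (fun x ↦ Bundle.TotalSpace.mk'
      (EuclideanSpace ℝ (Fin (4 * n)) →L[ℝ] EuclideanSpace ℝ (Fin (4 * n)) →L[ℝ] ℝ) x (θ x))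

/-- `J = (J₁, J₂, J₃)` (indexed by `0, 1, 2`) is a smooth local admissible basis of `Q` on the open
set `U`: a triple of almost complex structures with `J₁ J₂ = J₃ = - J₂ J₁` spanning `Q`. -/
structure IsAdmissibleBasis (Q : EndSubspaceField n M) (U : Set M) (J : Fin 3 → EndField n M) :
    Prop where
  isOpen : IsOpen U
  smooth : ∀ a, SmoothEndOn n (J a) U
  sq : ∀ x ∈ U, ∀ a, ∀ u : TangentSpace (𝓡 (4 * n)) x, J a x (J a x u) = -u
  mul : ∀ x ∈ U, ∀ u : TangentSpace (𝓡 (4 * n)) x, J 0 x (J 1 x u) = J 2 x u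
  anti : ∀ x ∈ U, ∀ u : TangentSpace (𝓡 (4 * n)) x, J 1 x (J 0 x u) = -J 2 x u
  span : ∀ x ∈ U, Q x = Submodule.span ℝ (Set.range fun a ↦ J a x)

/-- `Q` is an almost quaternionic structure: it has a smooth admissible basis around every
point. -/
def IsAlmostQuaternionic (Q : EndSubspaceField n M) : Prop :=
  ∀ x : M, ∃ (U : Set M) (J : Fin 3 → EndField n M), x ∈ U ∧ IsAdmissibleBasis n Q U J

/-- The form `θ` is non-degenerate at every point. -/
def Nondegenerate (θ : FormField n M) : Prop :=
  ∀ (x : M) (u : TangentSpace (𝓡 (4 * n)) x), (∀ w, θ x u w = 0) → u = 0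

/-- `(Q, θ)` is an almost quaternionic skew-Hermitian structure, i.e. an `SO*(2n)Sp(1)`-structure:
`Q` is an almost quaternionic structure and `θ` is a scalar 2-form with respect to `Q`, that is, a
non-degenerate smooth 2-form which is `Q`-Hermitian. -/
structure IsAlmostQSH (Q : EndSubspaceField n M) (θ : FormField n M) : Prop where
  quaternionic : IsAlmostQuaternionic n Q
  smooth : SmoothForm n θ
  alternating : ∀ (x : M) (u : TangentSpace (𝓡 (4 * n)) x), θ x u u = 0
  nondegenerate : Nondegenerate n θ
  hermitian : ∀ (U : Set M) (J : Fin 3 → EndField n M), IsAdmissibleBasis n Q U J →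
    ∀ x ∈ U, ∀ a, ∀ u w : TangentSpace (𝓡 (4 * n)) x, θ x (J a x u) (J a x w) = θ x u w

/-- `dθ = 0`, by the invariant formula for the exterior derivative of a 2-form. -/
def IsClosedForm (θ : FormField n M) : Prop :=
  ∀ (x : M) (X Y Z : VField n M), DiffAt n X x → DiffAt n Y x → DiffAt n Z x →
    mvfderiv (𝓡 (4 * n)) (fun y ↦ θ y (Y y) (Z y)) x (X x)
      - mvfderiv (𝓡 (4 * n)) (fun y ↦ θ y (X y) (Z y)) x (Y x)
      + mvfderiv (𝓡 (4 * n)) (fun y ↦ θ y (X y) (Y y)) x (Z x)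
      - θ x (VectorField.mlieBracket (𝓡 (4 * n)) X Y x) (Z x)
      + θ x (VectorField.mlieBracket (𝓡 (4 * n)) X Z x) (Y x)
      - θ x (VectorField.mlieBracket (𝓡 (4 * n)) Y Z x) (X x) = 0

/-- Two connections are the same: they agree on all vector fields, wherever these are
differentiable (the values of a `CovariantDerivative` on other fields carry no information). -/
def SameConn (D D' : Conn n M) : Prop :=
  ∀ (x : M) (Y : VField n M), DiffAt n Y x → D Y x = D' Y x

/-- `(∇_v θ)(Y, Z) = v(θ(Y, Z)) - θ(∇_v Y, Z) - θ(Y, ∇_v Z)` at the point `x`. -/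
def covForm (D : Conn n M) (θ : FormField n M) (x : M) (v : TangentSpace (𝓡 (4 * n)) x)
    (Y Z : VField n M) : ℝ :=
  mvfderiv (𝓡 (4 * n)) (fun y ↦ θ y (Y y) (Z y)) x v - θ x (D Y x v) (Z x) - θ x (Y x) (D Z x v)

/-- `∇θ = 0`. -/
def PreservesForm (D : Conn n M) (θ : FormField n M) : Prop :=
  ∀ (x : M) (v : TangentSpace (𝓡 (4 * n)) x) (Y Z : VField n M),
    DiffAt n Y x → DiffAt n Z x → covForm n D θ x v Y Z = 0

/-- `∇` preserves `Q`: for every smooth local section `σ` of `Q` and every tangent vector `v`, the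
endomorphism `∇_v σ`, given by `(∇_v σ) Y = ∇_v (σ Y) - σ (∇_v Y)`, lies in `Q`. -/
def PreservesQ (D : Conn n M) (Q : EndSubspaceField n M) : Prop :=
  ∀ (U : Set M) (σ : EndField n M), IsOpen U → SmoothEndOn n σ U → (∀ y ∈ U, σ y ∈ Q y) →
    ∀ x ∈ U, ∀ v : TangentSpace (𝓡 (4 * n)) x, ∃ q ∈ Q x, ∀ Y : VField n M, DiffAt n Y x →
      D (fun y ↦ σ y (Y y)) x v - σ x (D Y x v) = q (Y x)

/-- `(Q, θ)` is a quaternionic skew-Hermitian structure, i.e. a torsion-free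
`SO*(2n)Sp(1)`-structure: an almost quaternionic skew-Hermitian structure which is preserved by
some smooth torsion-free connection. -/
def IsQSH (Q : EndSubspaceField n M) (θ : FormField n M) : Prop :=
  IsAlmostQSH n Q θ ∧ ∃ D : Conn n M, CovariantDerivative.ContMDiffCovariantDerivative D ∞ ∧
    PreservesQ n D Q ∧ PreservesForm n D θ ∧ D.torsion = 0

/-- The `m`-th exterior power of a 2-form `θ`, as a function of `2m` vectors (which are labelled by
the pairs `(i, 0)`, `(i, 1)` with `i < m`). -/
def wedgePow (θ : FormField n M) (m : ℕ) (x : M)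
    (v : Fin m × Fin 2 → TangentSpace (𝓡 (4 * n)) x) : ℝ :=
  (1 / 2 ^ m : ℝ) * ∑ s : Equiv.Perm (Fin m × Fin 2),
    ((Equiv.Perm.sign s : ℤ) : ℝ) * ∏ i : Fin m, θ x (v (s (i, 0))) (v (s (i, 1)))

/-- The volume form `vol = θ^{2n}` of an almost quaternionic skew-Hermitian structure in
dimension `4n`. -/
def vol (θ : FormField n M) (x : M)
    (v : Fin (2 * n) × Fin 2 → TangentSpace (𝓡 (4 * n)) x) : ℝ :=
  wedgePow n θ (2 * n) x v

/-- `∇` preserves the `4n`-form `μ`: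
`v(μ(Y₁, …, Y_{4n})) = ∑ i, μ(Y₁, …, ∇_v Y_i, …, Y_{4n})`. -/
def PreservesVol (D : Conn n M)
    (μ : Π x : M, (Fin (2 * n) × Fin 2 → TangentSpace (𝓡 (4 * n)) x) → ℝ) : Prop :=
  ∀ (x : M) (v : TangentSpace (𝓡 (4 * n)) x) (Y : Fin (2 * n) × Fin 2 → VField n M),
    (∀ i, DiffAt n (Y i) x) →
    mvfderiv (𝓡 (4 * n)) (fun y ↦ μ y fun i ↦ Y i y) x v =
      ∑ i, μ x (Function.update (fun j ↦ Y j x) i (D (Y i) x v))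

/-- The tensor `T` is the value at `x` of the Nijenhuis tensor of `J`,
`N_J(X, Y) = [JX, JY] - J[JX, Y] - J[X, JY] - [X, Y]`. -/
def IsNijenhuisAt (J : EndField n M) (x : M)
    (T : TangentSpace (𝓡 (4 * n)) x →L[ℝ] TangentSpace (𝓡 (4 * n)) x →L[ℝ]
      TangentSpace (𝓡 (4 * n)) x) : Prop :=
  ∀ X Y : VField n M, DiffAt n X x → DiffAt n Y x →
    T (X x) (Y x) =
      VectorField.mlieBracket (𝓡 (4 * n)) (fun y ↦ J y (X y)) (fun y ↦ J y (Y y)) x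
      - J x (VectorField.mlieBracket (𝓡 (4 * n)) (fun y ↦ J y (X y)) Y x)
      - J x (VectorField.mlieBracket (𝓡 (4 * n)) X (fun y ↦ J y (Y y)) x)
      - VectorField.mlieBracket (𝓡 (4 * n)) X Y x

/-- `τ_a(u) = tr(J_a ∘ T_u) / (4n - 2)`, for an endomorphism `J = J_a` and a `(1, 2)`-tensor `T`
at `x`. -/
def tau {x : M} (J : TangentSpace (𝓡 (4 * n)) x →L[ℝ] TangentSpace (𝓡 (4 * n)) x)
    (T : TangentSpace (𝓡 (4 * n)) x →L[ℝ] TangentSpace (𝓡 (4 * n)) x →L[ℝ]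
      TangentSpace (𝓡 (4 * n)) x)
    (u : TangentSpace (𝓡 (4 * n)) x) : ℝ :=
  (1 / (4 * (n : ℝ) - 2)) *
    LinearMap.trace ℝ (TangentSpace (𝓡 (4 * n)) x) (J.comp (T u)).toLinearMap

/-- The unimodular Oproiu connection `∇^{Q, vol}` of an almost quaternionic structure `Q` and a
volume form `μ`: the smooth connection preserving `Q` and `μ` whose torsion is, for every local
admissible basis `(J_a)` of `Q`, equal to `T^H + ∑ a, ∂(τ_a ⊗ J_a)`. Here
`T^H = (1/6) ∑ a, N_{J_a}` (that is `(1/12) ∑ a, [[J_a, J_a]]` with the Nijenhuis brackets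
`[[J_a, J_a]] = 2 N_{J_a}`), `τ_a(u) = tr(J_a T^H_u) / (4n - 2)`, and `∂` is alternation,
`∂(τ ⊗ J)(u, w) = τ(u) J w - τ(w) J u`. -/
structure IsOproiu (Q : EndSubspaceField n M)
    (μ : Π x : M, (Fin (2 * n) × Fin 2 → TangentSpace (𝓡 (4 * n)) x) → ℝ) (D : Conn n M) :
    Prop where
  smooth : CovariantDerivative.ContMDiffCovariantDerivative D ∞
  preservesQ : PreservesQ n D Q
  preservesVol : PreservesVol n D μ
  torsion_eq : ∀ (U : Set M) (J : Fin 3 → EndField n M), IsAdmissibleBasis n Q U J → ∀ x ∈ U,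
    ∃ (N : Fin 3 → (TangentSpace (𝓡 (4 * n)) x →L[ℝ] TangentSpace (𝓡 (4 * n)) x →L[ℝ]
        TangentSpace (𝓡 (4 * n)) x))
      (TH : TangentSpace (𝓡 (4 * n)) x →L[ℝ] TangentSpace (𝓡 (4 * n)) x →L[ℝ]
        TangentSpace (𝓡 (4 * n)) x),
      (∀ a, IsNijenhuisAt n (J a) x (N a)) ∧ TH = (1 / 6 : ℝ) • ∑ a, N a ∧
      ∀ u w : TangentSpace (𝓡 (4 * n)) x,
        D.torsion x u w =
          TH u w + ∑ a, (tau n (J a x) TH u • J a x w - tau n (J a x) TH w • J a x u)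

/-- The minimal adapted connection `∇^{Q, θ} = ∇^{Q, vol} + A` of an almost quaternionic
skew-Hermitian structure, where `vol = θ^{2n}` and `A` is the tensor given by
`θ(A(X, Y), Z) = (1/2) (∇^{Q, vol}_X θ)(Y, Z)`. -/
def IsMinimalAdapted (Q : EndSubspaceField n M) (θ : FormField n M) (D : Conn n M) : Prop :=
  CovariantDerivative.ContMDiffCovariantDerivative D ∞ ∧
  ∃ D' : Conn n M, IsOproiu n Q (vol n θ) D' ∧
    ∀ (x : M) (v : TangentSpace (𝓡 (4 * n)) x) (Y Z : VField n M),
      DiffAt n Y x → DiffAt n Z x →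
      θ x (D Y x v - D' Y x v) (Z x) = (1 / 2 : ℝ) * covForm n D' θ x v Y Z

/-- `D` is the one and only connection with the property `P`. -/
def IsTheConn (P : Conn n M → Prop) (D : Conn n M) : Prop :=
  P D ∧ ∀ D' : Conn n M, P D' → SameConn n D' D

end Structures

section Submanifolds

variable {n k : ℕ} {M : Type*} [TopologicalSpace M]
  [ChartedSpace (EuclideanSpace ℝ (Fin (4 * n))) M] [IsManifold (𝓡 (4 * n)) ∞ M]
  {N : Type*} [TopologicalSpace N]
  [ChartedSpace (EuclideanSpace ℝ (Fin (4 * k))) N] [IsManifold (𝓡 (4 * k)) ∞ N]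

/-- The differential `ι_* : T_x N → T_{ι x} M`. -/
abbrev push (i : N → M) (x : N) :
    TangentSpace (𝓡 (4 * k)) x →L[ℝ] TangentSpace (𝓡 (4 * n)) (i x) :=
  mfderiv (𝓡 (4 * k)) (𝓡 (4 * n)) i x

/-- The smooth immersion `i : N → M` makes `N` an almost quaternionic submanifold of `(M, Q)`: its
tangent spaces are `Q`-invariant. -/
def IsAlmostQuaternionicSubmanifold (Q : EndSubspaceField n M) (i : N → M) : Prop :=
  Manifold.IsImmersion (𝓡 (4 * k)) (𝓡 (4 * n)) ∞ i ∧
  ∀ (x : N), ∀ J ∈ Q (i x), ∀ u : TangentSpace (𝓡 (4 * k)) x,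
    ∃ w : TangentSpace (𝓡 (4 * k)) x, J (push i x u) = push i x w

/-- The restriction `Q|_{TN}`: all endomorphisms of `T_x N` which are restrictions of elements of
`Q` at `i x`. -/
def restrictQ (Q : EndSubspaceField n M) (i : N → M) : EndSubspaceField k N := fun x ↦
  { carrier := {I | ∃ J ∈ Q (i x), ∀ u, push i x (I u) = J (push i x u)}
    add_mem' := by
      rintro I I' ⟨J, hJ, h⟩ ⟨J', hJ', h'⟩
      exact ⟨J + J', (Q (i x)).add_mem hJ hJ', fun u ↦ by simp [h, h']⟩
    zero_mem' := ⟨0, (Q (i x)).zero_mem, fun u ↦ by simp⟩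
    smul_mem' := by
      rintro c I ⟨J, hJ, h⟩
      exact ⟨c • J, (Q (i x)).smul_mem c hJ, fun u ↦ by simp [h]⟩ }

/-- The pull-back `i^* θ`, i.e. `(u, w) ↦ θ(i_* u, i_* w)`. -/
def pullForm (θ : FormField n M) (i : N → M) : FormField k N := fun x ↦
  (ContinuousLinearMap.precomp ℝ (push i x)).comp ((θ (i x)).comp (push i x))

/-- The connection `D'` on `N` is the restriction to `TN` of the connection `D` on `M`: if the
vector field `Y` on `M` extends the vector field `Y'` on `N` near `x`, then
`i_* (D'_v Y') = D_{i_* v} Y` for all `v ∈ T_x N`. In particular `D_X Y` is tangent to `N` for all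
`X, Y` tangent to `N`, that is, `N` is totally geodesic. -/
def IsRestriction (i : N → M) (D : Conn n M) (D' : Conn k N) : Prop :=
  ∀ (x : N) (Y' : VField k N) (Y : VField n M), DiffAt k Y' x → DiffAt n Y (i x) →
    (∀ᶠ y in 𝓝 x, push i y (Y' y) = Y (i y)) →
    ∀ v : TangentSpace (𝓡 (4 * k)) x, push i x (D' Y' x v) = D Y (i x) (push i x v)

end Submanifolds

end QSH

end

/-!
Let `D` be a torsion-free connection on `M` which preserves `Q` and `θ`.

*The canonical connections.* As `D` is torsion-free and preserves `Q`, the covariant derivative of a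
local admissible basis has the form `∇J₁ = c J₂ - b J₃` (and cyclically). A torsion-free connection
also computes Nijenhuis tensors, and inserting these formulas shows that the torsion prescribed for
the Oproiu connection vanishes (`oproiu_torsion_eq_zero`). As `D` preserves `θ`, it preserves
`vol = θ^{2n}`, so `D` is an Oproiu connection. Two of these differ by a symmetric tensor `A` such
that `A(X, ·)` normalizes the span of the `J_a` and has trace zero; such a tensor is zero
(`IsQuaternionTriple.prolongation_eq_zero`), which is the uniqueness statement
`sameConn_of_preserves`. It needs that `θ^{2n}` does not vanish (`exists_altPower_ne_zero`). The
minimal adapted connection then coincides with the Oproiu connection, because `∇θ = 0`. In this way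
both canonical connections of a torsion-free structure are identified with `D`, on `M` as well as
on `N`.

*The submanifold.* The second fundamental form of `N` with respect to `D`, with values in
`TM / TN`, is symmetric since `D` is torsion-free, and it commutes with the action of `J₁` and `J₂`
since `D` preserves `Q` and `TN` is `Q`-invariant. A symmetric bilinear map with
`A(X, JY) = J A(X, Y)` for two anticommuting complex structures vanishes
(`IsQuaternionTriple.eq_zero_of_symm_of_comm`). So `N` is totally geodesic
(`Extends.exists_conn_eq`), `D` restricts to a connection `D'` on `N` (`exists_isRestriction`), and
`D'` inherits smoothness, vanishing torsion and the parallelism of `Q|_{TN}` and `i^* θ`. Hence the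
restricted structure is torsion-free, its canonical connection is `D'` by the first part, and
`i^* θ` is closed because it is preserved by a torsion-free connection.

All this uses extensions of vector fields from `N` to `M`, which are obtained from a local smooth
left inverse of the immersion (`exists_retraction`).
-/

noncomputable section

namespace QSH

/-! ### Quaternionic linear algebra -/

section LinearAlgebra

variable {V : Type*} [AddCommGroup V] [Module ℝ V]

/-- `I, J, K` are endomorphisms satisfying the multiplication rules of the quaternion units. -/
structure IsQuaternionTriple (I J K : Module.End ℝ V) : Prop where
  II : I * I = -1
  JJ : J * J = -1
  IJ : I * J = K
  JI : J * I = -K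

/-- The endomorphism-valued form of the Nijenhuis tensor of an almost complex structure `I` with
covariant derivative `q` under a torsion-free connection. -/
def nijenhuisForm (I : Module.End ℝ V) (q : V →ₗ[ℝ] Module.End ℝ V) (u w : V) : V :=
  q (I u) w - q (I w) u - I (q u w) + I (q w u)

namespace IsQuaternionTriple

variable {I J K : Module.End ℝ V}

lemma KJ (h : IsQuaternionTriple I J K) : K * J = -I := by
  rw [← h.IJ, mul_assoc, h.JJ, mul_neg_one]

lemma IK (h : IsQuaternionTriple I J K) : I * K = -J := by
  rw [← h.IJ, ← mul_assoc, h.II, neg_one_mul]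

lemma JK (h : IsQuaternionTriple I J K) : J * K = I := by
  rw [← h.IJ, ← mul_assoc, h.JI, neg_mul, h.KJ, neg_neg]

lemma KI (h : IsQuaternionTriple I J K) : K * I = J := by
  rw [← h.IJ, mul_assoc, h.JI, mul_neg, h.IK, neg_neg]

lemma KK (h : IsQuaternionTriple I J K) : K * K = -1 := by
  rw [← h.IJ, mul_assoc, ← mul_assoc J, h.JI, neg_mul, h.KJ, mul_neg, mul_neg, h.II, neg_neg]

/-- Cyclic permutation of the quaternion units. -/
lemma rotate (h : IsQuaternionTriple I J K) : IsQuaternionTriple J K I :=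
  ⟨h.JJ, h.KK, h.JK, h.KJ⟩

open LinearMap (trace)

lemma trace_K (h : IsQuaternionTriple I J K) : trace ℝ V K = 0 := by
  have h1 : trace ℝ V (I * J) = trace ℝ V (J * I) := LinearMap.trace_mul_comm ℝ I J
  rw [h.IJ, h.JI, map_neg] at h1
  linarith

lemma trace_I (h : IsQuaternionTriple I J K) : trace ℝ V I = 0 := h.rotate.trace_K

lemma trace_J (h : IsQuaternionTriple I J K) : trace ℝ V J = 0 := h.rotate.rotate.trace_K

lemma apply_II (h : IsQuaternionTriple I J K) (u : V) : I (I u) = -u := by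
  simpa using congr($(h.II) u)
lemma apply_JJ (h : IsQuaternionTriple I J K) (u : V) : J (J u) = -u := by
  simpa using congr($(h.JJ) u)
lemma apply_KK (h : IsQuaternionTriple I J K) (u : V) : K (K u) = -u := by
  simpa using congr($(h.KK) u)
lemma apply_IJ (h : IsQuaternionTriple I J K) (u : V) : I (J u) = K u := by
  simpa using congr($(h.IJ) u)
lemma apply_JI (h : IsQuaternionTriple I J K) (u : V) : J (I u) = -K u := by
  simpa using congr($(h.JI) u)
lemma apply_IK (h : IsQuaternionTriple I J K) (u : V) : I (K u) = -J u := by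
  simpa using congr($(h.IK) u)
lemma apply_KI (h : IsQuaternionTriple I J K) (u : V) : K (I u) = J u := by
  simpa using congr($(h.KI) u)
lemma apply_JK (h : IsQuaternionTriple I J K) (u : V) : J (K u) = I u := by
  simpa using congr($(h.JK) u)
lemma apply_KJ (h : IsQuaternionTriple I J K) (u : V) : K (J u) = -I u := by
  simpa using congr($(h.KJ) u)

/-- A symmetric bilinear map commuting with the quaternion units in its second argument vanishes,
since it is then quaternion linear in both arguments and `I`, `J` do not commute. -/
lemma eq_zero_of_symm_of_comm {V' : Type*} (h : IsQuaternionTriple I J K) {I' J' : V' → V'}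
    (A : V' → V' → V) (hsymm : ∀ X Y, A X Y = A Y X)
    (hI : ∀ X Y, A X (I' Y) = I (A X Y)) (hJ : ∀ X Y, A X (J' Y) = J (A X Y)) (X Y : V') :
    A X Y = 0 := by
  have e : I (J (A X Y)) = J (I (A X Y)) := by
    rw [← hJ X Y, hsymm X (J' Y), ← hI, hsymm (J' Y), hJ, hsymm (I' X), hI, hsymm Y]
  rw [h.apply_IJ, h.apply_JI, eq_neg_iff_add_eq_zero, ← two_smul ℝ, smul_eq_zero] at e
  have e' := h.apply_KK (A X Y)
  rwa [e.resolve_left two_ne_zero, map_zero, eq_comm, neg_eq_zero] at e'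

lemma trace_of_mem_span (h : IsQuaternionTriple I J K)
    {q : Module.End ℝ V} (hq : q ∈ Submodule.span ℝ {I, J, K}) : trace ℝ V q = 0 := by
  obtain ⟨a, b, c, rfl⟩ := Submodule.mem_span_triple.mp hq
  simp [h.trace_I, h.trace_J, h.trace_K]

/-- With `q₁ = c J - b K` and so on, the sum of the three Nijenhuis tensors is `6 ∑ ∂(σ_a ⊗ J_a)`,
where `6 σ₁ = -2 a - c ∘ J + b ∘ K` and cyclically. These forms satisfy the trace identity which
makes the torsion of the Oproiu connection vanish. -/
lemma exists_torsion_forms (h : IsQuaternionTriple I J K)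
    (q₁ q₂ q₃ : V →ₗ[ℝ] Module.End ℝ V)
    (a b c : V →ₗ[ℝ] ℝ) (hq : ∀ v, q₁ v = c v • J - b v • K ∧ q₂ v = a v • K - c v • I ∧
      q₃ v = b v • I - a v • J) :
    ∃ s₁ s₂ s₃ : V →ₗ[ℝ] ℝ,
      (∀ u w, (1 / 6 : ℝ) • (nijenhuisForm I q₁ u w + nijenhuisForm J q₂ u w
          + nijenhuisForm K q₃ u w)
        = (s₁ u • I w - s₁ w • I u) + (s₂ u • J w - s₂ w • J u) + (s₃ u • K w - s₃ w • K u)) ∧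
      (∀ u, s₂ (K u) - s₃ (J u) = -s₁ u) ∧ (∀ u, s₃ (I u) - s₁ (K u) = -s₂ u) ∧
      (∀ u, s₁ (J u) - s₂ (I u) = -s₃ u) := by
  refine ⟨(1 / 6 : ℝ) • (-(2 : ℝ) • a - c ∘ₗ J + b ∘ₗ K),
    (1 / 6 : ℝ) • (-(2 : ℝ) • b - a ∘ₗ K + c ∘ₗ I),
    (1 / 6 : ℝ) • (-(2 : ℝ) • c - b ∘ₗ I + a ∘ₗ J), fun u w ↦ ?_, fun u ↦ ?_, fun u ↦ ?_,
    fun u ↦ ?_⟩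
  · simp only [nijenhuisForm, (hq _).1, (hq _).2.1, (hq _).2.2, LinearMap.sub_apply,
      LinearMap.add_apply, LinearMap.smul_apply, LinearMap.comp_apply, map_sub, map_smul,
      h.apply_IJ, h.apply_JI, h.apply_IK, h.apply_KI, h.apply_JK, h.apply_KJ, smul_eq_mul]
    module
  all_goals
    simp only [LinearMap.sub_apply,
      LinearMap.add_apply, LinearMap.smul_apply, LinearMap.comp_apply, map_neg,
      h.apply_IJ, h.apply_JI, h.apply_IK, h.apply_KI, h.apply_JK, h.apply_KJ, smul_eq_mul,
      h.apply_II, h.apply_JJ, h.apply_KK]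
    ring

/-- The structure induced on a quotient by an invariant subspace. -/
lemma mapQ (h : IsQuaternionTriple I J K) {S : Submodule ℝ V} (hI : S ≤ S.comap I)
    (hJ : S ≤ S.comap J) (hK : S ≤ S.comap K) : IsQuaternionTriple (S.mapQ S I hI) (S.mapQ S J hJ) (S.mapQ S K hK) where
  II := by
    ext u
    have := congrArg S.mkQ (DFunLike.congr_fun h.II u)
    simpa using this
  JJ := by
    ext u
    have := congrArg S.mkQ (DFunLike.congr_fun h.JJ u)
    simpa using this
  IJ := by
    ext u
    have := congrArg S.mkQ (DFunLike.congr_fun h.IJ u)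
    simpa using this
  JI := by
    ext u
    have := congrArg S.mkQ (DFunLike.congr_fun h.JI u)
    simpa using this

/-- If a form is Hermitian with respect to the units `I, J, K`, then it is Hermitian with respect
to each complex structure in their span. -/
lemma hermitian (h : IsQuaternionTriple I J K) (B : V →ₗ[ℝ] V →ₗ[ℝ] ℝ)
    (hI : ∀ u w, B (I u) (I w) = B u w) (hJ : ∀ u w, B (J u) (J w) = B u w)
    (hK : ∀ u w, B (K u) (K w) = B u w) (a b c : ℝ) {u₀ : V} (hu₀ : u₀ ≠ 0)
    (hsq : (a • I + b • J + c • K) ((a • I + b • J + c • K) u₀) = -u₀) (u w : V) :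
    B ((a • I + b • J + c • K) u) ((a • I + b • J + c • K) w) = B u w := by
  have habc : a ^ 2 + b ^ 2 + c ^ 2 = 1 := by
    have : (a ^ 2 + b ^ 2 + c ^ 2 - 1) • u₀ = 0 := by
      simp only [LinearMap.add_apply, LinearMap.smul_apply, map_add, map_smul, h.apply_II,
        h.apply_JJ, h.apply_KK, h.apply_IJ, h.apply_JI, h.apply_IK, h.apply_KI, h.apply_JK,
        h.apply_KJ] at hsq
      rw [← sub_eq_zero, ← neg_eq_zero] at hsq
      rw [← hsq]
      module
    linarith [(smul_eq_zero.mp this).resolve_right hu₀]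
  have e1 : B (I u) (J w) + B (J u) (I w) = 0 := by
    have h1 := hI (I u) (J w)
    have h2 := hJ (J u) (I w)
    rw [h.apply_II, h.apply_IJ, map_neg, LinearMap.neg_apply] at h1
    rw [h.apply_JJ, h.apply_JI, map_neg, map_neg, LinearMap.neg_apply] at h2
    linarith
  have e2 : B (J u) (K w) + B (K u) (J w) = 0 := by
    have h1 := hJ (J u) (K w)
    have h2 := hK (K u) (J w)
    rw [h.apply_JJ, h.apply_JK, map_neg, LinearMap.neg_apply] at h1
    rw [h.apply_KK, h.apply_KJ, map_neg, map_neg, LinearMap.neg_apply] at h2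
    linarith
  have e3 : B (K u) (I w) + B (I u) (K w) = 0 := by
    have h1 := hK (K u) (I w)
    have h2 := hI (I u) (K w)
    rw [h.apply_KK, h.apply_KI, map_neg, LinearMap.neg_apply] at h1
    rw [h.apply_II, h.apply_IK, map_neg, map_neg, LinearMap.neg_apply] at h2
    linarith
  simp only [LinearMap.add_apply, LinearMap.smul_apply, map_add, map_smul, smul_eq_mul, hI, hJ, hK]
  linear_combination B u w * habc + a * b * e1 + b * c * e2 + a * c * e3

variable [FiniteDimensional ℝ V]

/-- The coefficients of an element of the span of the quaternion units are given by the trace form,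
because `tr 1 = dim V` and the products of distinct units are trace free. -/
lemma eq_of_mem_span (h : IsQuaternionTriple I J K) (hd : (Module.finrank ℝ V : ℝ) ≠ 0)
    {q : Module.End ℝ V} (hq : q ∈ Submodule.span ℝ {I, J, K}) :
    q = (-(1 / (Module.finrank ℝ V : ℝ)) * trace ℝ V (I * q)) • I
      + (-(1 / (Module.finrank ℝ V : ℝ)) * trace ℝ V (J * q)) • J
      + (-(1 / (Module.finrank ℝ V : ℝ)) * trace ℝ V (K * q)) • K := by
  obtain ⟨a, b, c, rfl⟩ := Submodule.mem_span_triple.mp hq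
  simp only [mul_add, mul_smul_comm, h.II, h.IJ, h.IK, h.JI, h.JJ, h.JK, h.KI, h.KJ, h.KK,
    map_add, map_smul, map_neg, h.trace_I, h.trace_J, h.trace_K, LinearMap.trace_one, smul_eq_mul]
  congr 3 <;> field_simp <;> ring

/-- An endomorphism normalising the span of the quaternion units differs from an element of that
span by an endomorphism commuting with the units. -/
lemma commutator_eq (h : IsQuaternionTriple I J K) (hd : (Module.finrank ℝ V : ℝ) ≠ 0)
    {A : Module.End ℝ V} (hI : A * I - I * A ∈ Submodule.span ℝ {I, J, K}) :
    A * I - I * A = (2 * (1 / (Module.finrank ℝ V : ℝ)) * trace ℝ V (J * A)) • K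
      - (2 * (1 / (Module.finrank ℝ V : ℝ)) * trace ℝ V (K * A)) • J := by
  have c : ∀ X : Module.End ℝ V, trace ℝ V (X * (A * I - I * A))
      = trace ℝ V ((I * X - X * I) * A) := by
    intro X
    rw [mul_sub, map_sub, sub_mul, map_sub, ← mul_assoc, LinearMap.trace_mul_comm ℝ (X * A) I,
      ← mul_assoc, ← mul_assoc]
  rw [h.eq_of_mem_span hd hI, c, c, c, h.IJ, h.JI, h.IK, h.KI, sub_self, zero_mul, map_zero]
  have e1 : (K - -K) * A = (2 : ℝ) • (K * A) := by rw [sub_neg_eq_add, add_mul, two_smul]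
  have e2 : (-J - J) * A = -((2 : ℝ) • (J * A)) := by
    rw [sub_mul, neg_mul, two_smul]; abel
  rw [e1, e2, map_neg, map_smul, map_smul]
  simp only [smul_eq_mul]
  module

/-- The first prolongation of `𝔰𝔩(n, ℍ) ⊕ 𝔰𝔭(1)` vanishes: a symmetric tensor `A : V × V → V`
such that every `A(X, ·)` is trace free and normalises the span of the quaternion units is zero. -/
theorem prolongation_eq_zero (h : IsQuaternionTriple I J K)
    (hd : 2 < Module.finrank ℝ V) (A : V →ₗ[ℝ] Module.End ℝ V)
    (hsymm : ∀ X Y, A X Y = A Y X) (htr : ∀ X, trace ℝ V (A X) = 0)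
    (hI : ∀ X, A X * I - I * A X ∈ Submodule.span ℝ {I, J, K})
    (hJ : ∀ X, A X * J - J * A X ∈ Submodule.span ℝ {I, J, K})
    (hK : ∀ X, A X * K - K * A X ∈ Submodule.span ℝ {I, J, K}) : A = 0 := by
  have hd2 : (2 : ℝ) < Module.finrank ℝ V := by exact_mod_cast hd
  have hd0 : (Module.finrank ℝ V : ℝ) ≠ 0 := by linarith
  set d : ℝ := ((Module.finrank ℝ V : ℕ) : ℝ)
  have s1 : ({J, K, I} : Set (Module.End ℝ V)) = {I, J, K} := by ext x; simp; tauto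
  have s2 : ({K, I, J} : Set (Module.End ℝ V)) = {I, J, K} := by ext x; simp; tauto
  -- Up to the factor `-1/d`, the components of `A X` along the quaternion units.
  let t (L : Module.End ℝ V) : V →ₗ[ℝ] ℝ :=
    (trace ℝ V) ∘ₗ (LinearMap.mulLeft ℝ L) ∘ₗ A
  have ht (L : Module.End ℝ V) (X : V) : t L X = trace ℝ V (L * A X) := rfl
  have cI (X : V) : A X * I - I * A X = (2 * (1 / d) * t J X) • K - (2 * (1 / d) * t K X) • J :=
    h.commutator_eq hd0 (hI X)
  have cJ (X : V) : A X * J - J * A X = (2 * (1 / d) * t K X) • I - (2 * (1 / d) * t I X) • K :=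
    h.rotate.commutator_eq hd0 (by rw [s1]; exact hJ X)
  have cK (X : V) : A X * K - K * A X = (2 * (1 / d) * t I X) • J - (2 * (1 / d) * t J X) • I :=
    h.rotate.rotate.commutator_eq hd0 (by rw [s2]; exact hK X)
  -- By symmetry, `tr (Y ↦ A Y Z) = tr (A Z) = 0`; this turns `tr (L ∘ A X)` into the trace of a
  -- commutator, that is, into a linear relation between the components of `A`.
  have key (L : Module.End ℝ V) (X : V) (f g : V →ₗ[ℝ] ℝ) (P Q : Module.End ℝ V)
      (hc : ∀ Y, A Y * L - L * A Y = f Y • P - g Y • Q) :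
      t L X = -(f (P X) - g (Q X)) := by
    have e : L * A X = A (L X) - (f.smulRight (P X) - g.smulRight (Q X)) := by
      ext Y
      have := congr($(hc Y) X)
      simp only [LinearMap.sub_apply, LinearMap.smul_apply, Module.End.mul_apply,
        LinearMap.smulRight_apply] at this ⊢
      rw [← this, hsymm (L X) Y, hsymm X Y]
      abel
    rw [ht, e, map_sub, htr, map_sub, LinearMap.trace_smulRight, LinearMap.trace_smulRight]
    simp
  have kI (X : V) : d * t I X = -(2 * (t J (K X) - t K (J X))) := by
    rw [key I X ((2 * (1 / d)) • t J) ((2 * (1 / d)) • t K) K J (fun Y ↦ by simpa using cI Y)]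
    simp only [LinearMap.smul_apply, smul_eq_mul]
    field_simp
    try ring
  have kJ (X : V) : d * t J X = -(2 * (t K (I X) - t I (K X))) := by
    rw [key J X ((2 * (1 / d)) • t K) ((2 * (1 / d)) • t I) I K (fun Y ↦ by simpa using cJ Y)]
    simp only [LinearMap.smul_apply, smul_eq_mul]
    field_simp
    try ring
  have kK (X : V) : d * t K X = -(2 * (t I (J X) - t J (I X))) := by
    rw [key K X ((2 * (1 / d)) • t I) ((2 * (1 / d)) • t J) J I (fun Y ↦ by simpa using cK Y)]
    simp only [LinearMap.smul_apply, smul_eq_mul]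
    field_simp
    try ring
  -- Evaluate the three relations at `I X`, `J X`, `K X`, respectively.
  have z (X : V) : t I (I X) = 0 ∧ t J (J X) = 0 ∧ t K (K X) = 0 := by
    have e1 := kI (I X)
    have e2 := kJ (J X)
    have e3 := kK (K X)
    rw [h.apply_KI, h.apply_JI, map_neg] at e1
    rw [h.apply_IJ, h.apply_KJ, map_neg] at e2
    rw [h.apply_JK, h.apply_IK, map_neg] at e3
    have s : (d + 4) * (t I (I X) + t J (J X) + t K (K X)) = 0 := by linarith
    have s' : t I (I X) + t J (J X) + t K (K X) = 0 := by
      rcases mul_eq_zero.mp s with s | s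
      · linarith
      · exact s
    have hd' : d - 2 ≠ 0 := by linarith
    refine ⟨?_, ?_, ?_⟩ <;> refine (mul_eq_zero.mp (?_ : (d - 2) * _ = 0)).resolve_left hd' <;>
      linarith
  have tI (X : V) : t I X = 0 := by
    have := (z (I X)).1
    rwa [h.apply_II, map_neg, neg_eq_zero] at this
  have tJ (X : V) : t J X = 0 := by
    have := (z (J X)).2.1
    rwa [h.apply_JJ, map_neg, neg_eq_zero] at this
  have tK (X : V) : t K X = 0 := by
    have := (z (K X)).2.2
    rwa [h.apply_KK, map_neg, neg_eq_zero] at this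
  have dI (X Y : V) : A X (I Y) = I (A X Y) := by
    have := congr($(cI X) Y)
    simpa [tJ, tK, sub_eq_zero] using this
  have dJ (X Y : V) : A X (J Y) = J (A X Y) := by
    have := congr($(cJ X) Y)
    simpa [tI, tK, sub_eq_zero] using this
  ext X Y
  exact h.eq_zero_of_symm_of_comm (fun X Y ↦ A X Y) hsymm dI dJ X Y

/-- Let `q₁, q₂, q₃` satisfy the relations that hold between the covariant derivatives of the units
`I, J, K` with respect to a connection preserving their span. Then `q₁ = c J - b K`,
`q₂ = -c I + a K` and `q₃ = b I - a J` for linear forms `a, b, c`. -/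
lemma exists_connection_forms (h : IsQuaternionTriple I J K)
    (hd : (Module.finrank ℝ V : ℝ) ≠ 0) (q₁ q₂ q₃ : V →ₗ[ℝ] Module.End ℝ V)
    (m₁ : ∀ v, q₁ v ∈ Submodule.span ℝ {I, J, K}) (m₂ : ∀ v, q₂ v ∈ Submodule.span ℝ {I, J, K})
    (m₃ : ∀ v, q₃ v ∈ Submodule.span ℝ {I, J, K})
    (r₁ : ∀ v, q₁ v * I + I * q₁ v = 0) (r₂ : ∀ v, q₂ v * J + J * q₂ v = 0)
    (r₃ : ∀ v, q₁ v * J + I * q₂ v = q₃ v) (r₄ : ∀ v, q₂ v * I + J * q₁ v = -q₃ v) :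
    ∃ a b c : V →ₗ[ℝ] ℝ, ∀ v, q₁ v = c v • J - b v • K ∧ q₂ v = a v • K - c v • I ∧
      q₃ v = b v • I - a v • J := by
  set d : ℝ := ((Module.finrank ℝ V : ℕ) : ℝ) with hdd
  refine ⟨-(1 / d) • ((trace ℝ V) ∘ₗ (LinearMap.mulLeft ℝ K) ∘ₗ q₂),
    (1 / d) • ((trace ℝ V) ∘ₗ (LinearMap.mulLeft ℝ K) ∘ₗ q₁),
    -(1 / d) • ((trace ℝ V) ∘ₗ (LinearMap.mulLeft ℝ J) ∘ₗ q₁), fun v ↦ ?_⟩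
  have n₁ : trace ℝ V (I * q₁ v) = 0 := by
    have := congr(trace ℝ V $(r₁ v))
    rw [map_add, LinearMap.trace_mul_comm, map_zero] at this
    linarith
  have n₂ : trace ℝ V (J * q₂ v) = 0 := by
    have := congr(trace ℝ V $(r₂ v))
    rw [map_add, LinearMap.trace_mul_comm, map_zero] at this
    linarith
  have t₁ := h.trace_of_mem_span (m₁ v)
  have t₂ := h.trace_of_mem_span (m₂ v)
  have o : trace ℝ V (I * q₂ v) = -trace ℝ V (J * q₁ v) := by
    have := congr(trace ℝ V ($(r₃ v) + $(r₄ v)))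
    rw [map_add, map_add, map_add, LinearMap.trace_mul_comm ℝ (q₁ v),
      LinearMap.trace_mul_comm ℝ (q₂ v), add_neg_cancel, map_zero] at this
    linarith
  have l (L : Module.End ℝ V) : trace ℝ V (L * q₃ v)
      = trace ℝ V (J * L * q₁ v) + trace ℝ V (L * I * q₂ v) := by
    rw [← r₃, mul_add, map_add, ← mul_assoc, LinearMap.trace_mul_comm ℝ (L * q₁ v), mul_assoc,
      mul_assoc]
  have p₁ : trace ℝ V (I * q₃ v) = -trace ℝ V (K * q₁ v) := by
    rw [l, h.JI, h.II, neg_mul, neg_mul, one_mul, map_neg, map_neg, t₂]; simp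
  have p₂ : trace ℝ V (J * q₃ v) = -trace ℝ V (K * q₂ v) := by
    rw [l, h.JI, h.JJ, neg_mul, neg_mul, one_mul, map_neg, map_neg, t₁]; simp
  have p₃ : trace ℝ V (K * q₃ v) = 0 := by
    rw [l, h.JK, h.KI, n₁, n₂, add_zero]
  simp only [LinearMap.smul_apply, LinearMap.comp_apply, LinearMap.mulLeft_apply, smul_eq_mul]
  refine ⟨?_, ?_, ?_⟩
  · conv_lhs => rw [h.eq_of_mem_span hd (m₁ v), n₁]
    rw [← hdd]; module
  · conv_lhs => rw [h.eq_of_mem_span hd (m₂ v), n₂, o]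
    rw [← hdd]; module
  · conv_lhs => rw [h.eq_of_mem_span hd (m₃ v), p₁, p₂, p₃]
    rw [← hdd]; module

/-- If `T(u, ·) = ∑ b, (σ_b(u) J_b - σ_b ⊗ J_b u)`, then
`tr(J₁ ∘ T(u, ·)) = -dim V σ₁(u) - ∑ b, σ_b(J₁ J_b u)`. -/
lemma trace_mul_torsion (h : IsQuaternionTriple I J K) (s₁ s₂ s₃ : V →ₗ[ℝ] ℝ)
    (h₁ : ∀ u, s₂ (K u) - s₃ (J u) = -s₁ u) (u : V) (T : Module.End ℝ V)
    (hT : ∀ w, T w = (s₁ u • I w - s₁ w • I u) + (s₂ u • J w - s₂ w • J u)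
      + (s₃ u • K w - s₃ w • K u)) :
    trace ℝ V (I * T) = -(Module.finrank ℝ V - 2) * s₁ u := by
  have e : I * T = (s₁ u • (-1 : Module.End ℝ V) + s₁.smulRight u)
      + (s₂ u • K - s₂.smulRight (K u)) + (s₃ u • (-J) + s₃.smulRight (J u)) := by
    ext w
    simp only [Module.End.mul_apply, hT, map_add, map_sub, map_smul, h.apply_II, h.apply_IJ,
      h.apply_IK, LinearMap.add_apply, LinearMap.sub_apply, LinearMap.smul_apply,
      LinearMap.neg_apply, LinearMap.smulRight_apply, Module.End.one_apply]
    module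
  rw [e]
  simp only [map_add, map_sub, map_smul, map_neg, h.trace_J, h.trace_K, LinearMap.trace_one,
    LinearMap.trace_smulRight, smul_eq_mul]
  linear_combination -h₁ u

end IsQuaternionTriple
end LinearAlgebra

/-! ### The top power of a symplectic form -/

section TopPower

variable {V : Type*} [AddCommGroup V] [Module ℝ V]

/-- The standard symplectic form on `ℝ²`, evaluated on basis vectors. -/
def planeForm (a b : Fin 2) : ℝ := if a = b then 0 else if a = 0 then 1 else -1

/-- A nondegenerate alternating form has a symplectic basis. -/
lemma exists_symplectic_family (m : ℕ) {V : Type*} [AddCommGroup V] [Module ℝ V]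
    [FiniteDimensional ℝ V] (hV : Module.finrank ℝ V = 2 * m) (B : V →ₗ[ℝ] V →ₗ[ℝ] ℝ)
    (hB : ∀ u, B u u = 0) (hnd : ∀ u, (∀ w, B u w = 0) → u = 0) :
    ∃ e : Fin m × Fin 2 → V, ∀ p q, B (e p) (e q) = if p.1 = q.1 then planeForm p.2 q.2 else 0 := by
  induction m generalizing V with
  | zero => exact ⟨fun p ↦ 0, fun p ↦ p.1.elim0⟩
  | succ m ih =>
    have hskew (u w : V) : B w u = -B u w := by
      have := hB (u + w)
      simp only [map_add, LinearMap.add_apply, hB] at this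
      linarith
    have : Nontrivial V := Module.nontrivial_of_finrank_pos (R := ℝ) (by omega)
    obtain ⟨x, hx⟩ := exists_ne (0 : V)
    obtain ⟨y', hy'⟩ : ∃ w, B x w ≠ 0 := by
      by_contra! h
      exact hx (hnd x h)
    set y : V := (B x y')⁻¹ • y' with hy
    have hxy : B x y = 1 := by rw [hy, map_smul, smul_eq_mul, inv_mul_cancel₀ hy']
    have hyx : B y x = -1 := by rw [hskew, hxy]
    let W : Submodule ℝ V := LinearMap.ker ((B x).prod (B y))
    have hW (z : V) : z ∈ W ↔ B x z = 0 ∧ B y z = 0 := by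
      simp [W, LinearMap.mem_ker]
    have hsurj : LinearMap.range ((B x).prod (B y)) = ⊤ := by
      rw [LinearMap.range_eq_top]
      rintro ⟨s, t⟩
      refine ⟨s • y - t • x, ?_⟩
      simp [hB, hxy, hyx]
    have hWd : Module.finrank ℝ W = 2 * m := by
      have := LinearMap.finrank_range_add_finrank_ker ((B x).prod (B y))
      rw [hsurj, finrank_top, Module.finrank_prod, Module.finrank_self] at this
      change _ + Module.finrank ℝ W = _ at this
      omega
    obtain ⟨e, he⟩ := ih hWd (B.domRestrict₁₂ W W) (fun u ↦ hB u) (fun u hu ↦ by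
      refine Subtype.ext (hnd _ fun v ↦ ?_)
      have hv : v - B x v • y + B y v • x ∈ W := by
        rw [hW]; simp [hB, hxy, hyx]
      have := hu ⟨_, hv⟩
      have hu' := (hW u).mp u.2
      simp only [LinearMap.domRestrict₁₂_apply, map_add, map_sub, map_smul, hskew x u.1,
        hskew y u.1, hu'.1, hu'.2] at this
      simpa using this)
    have he' (p q) : B (e p) (e q) = if p.1 = q.1 then planeForm p.2 q.2 else 0 := he p q
    refine ⟨fun p ↦ Fin.cases (if p.2 = 0 then x else y) (fun i ↦ (e (i, p.2) : V)) p.1, ?_⟩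
    rintro ⟨i, a⟩ ⟨j, b⟩
    have hWe (p) := (hW (e p)).mp (e p).2
    cases i using Fin.cases with
    | zero =>
      cases j using Fin.cases with
      | zero => fin_cases a <;> fin_cases b <;> simp [planeForm, hB, hxy, hyx]
      | succ j => fin_cases a <;> simp [hWe, (Fin.succ_ne_zero _).symm]
    | succ i =>
      cases j using Fin.cases with
      | zero => fin_cases b <;> simp [hskew x, hskew y, hWe, Fin.succ_ne_zero]
      | succ j => simp [he', Fin.succ_inj]

/-- The multilinear map `(v_{i,a}) ↦ ∏ i, B(v_{i,0}, v_{i,1})`. -/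
def pairProduct (m : ℕ) (B : V →ₗ[ℝ] V →ₗ[ℝ] ℝ) :
    MultilinearMap ℝ (fun _ : Fin m × Fin 2 ↦ V) ℝ where
  toFun v := ∏ i, B (v (i, 0)) (v (i, 1))
  map_update_add' := by
    rintro inst v ⟨i, a⟩ x y
    obtain rfl : inst = instDecidableEqProd := Subsingleton.elim _ _
    have h (z : V) : ∏ j ∈ Finset.univ.erase i, B (Function.update v (i, a) z (j, 0))
        (Function.update v (i, a) z (j, 1))
        = ∏ j ∈ Finset.univ.erase i, B (v (j, 0)) (v (j, 1)) := by
      refine Finset.prod_congr rfl fun j hj ↦ ?_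
      have hj := Finset.ne_of_mem_erase hj
      simp [Function.update_of_ne, hj]
    simp only [← Finset.mul_prod_erase _ _ (Finset.mem_univ i), h]
    fin_cases a <;> simp [add_mul]
  map_update_smul' := by
    rintro inst v ⟨i, a⟩ c x
    obtain rfl : inst = instDecidableEqProd := Subsingleton.elim _ _
    have h (z : V) : ∏ j ∈ Finset.univ.erase i, B (Function.update v (i, a) z (j, 0))
        (Function.update v (i, a) z (j, 1))
        = ∏ j ∈ Finset.univ.erase i, B (v (j, 0)) (v (j, 1)) := by
      refine Finset.prod_congr rfl fun j hj ↦ ?_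
      have hj := Finset.ne_of_mem_erase hj
      simp [Function.update_of_ne, hj]
    simp only [← Finset.mul_prod_erase _ _ (Finset.mem_univ i), h]
    fin_cases a <;> simp [mul_assoc]

/-- Up to the factor `2^{-m}`, the `m`-th exterior power of `B`, as an alternating map. -/
def altPower (m : ℕ) (B : V →ₗ[ℝ] V →ₗ[ℝ] ℝ) : V [⋀^Fin m × Fin 2]→ₗ[ℝ] ℝ :=
  MultilinearMap.alternatization (pairProduct m B)

lemma altPower_apply (m : ℕ) (B : V →ₗ[ℝ] V →ₗ[ℝ] ℝ) (v : Fin m × Fin 2 → V) :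
    altPower m B v = ∑ s : Equiv.Perm (Fin m × Fin 2),
      ((Equiv.Perm.sign s : ℤ) : ℝ) * ∏ i : Fin m, B (v (s (i, 0))) (v (s (i, 1))) := by
  rw [altPower, MultilinearMap.alternatization_apply]
  refine Finset.sum_congr rfl fun s _ ↦ ?_
  rw [Units.smul_def, zsmul_eq_mul]
  rfl

/-- In the expansion of `B^m` on a symplectic basis, a permutation contributes only if it permutes
the pairs `{(i, 0), (i, 1)}`, and then its sign is the product of the signs of the transpositions
it induces within the pairs, hence cancels the sign of the product of the values of `B`. -/
lemma sign_mul_prod_planeForm_nonneg (m : ℕ) (s : Equiv.Perm (Fin m × Fin 2)) :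
    0 ≤ ((Equiv.Perm.sign s : ℤ) : ℝ) * ∏ i : Fin m,
      (if (s (i, 0)).1 = (s (i, 1)).1 then planeForm (s (i, 0)).2 (s (i, 1)).2 else 0) := by
  by_cases h : ∀ i, (s (i, 0)).1 = (s (i, 1)).1
  swap
  · push Not at h
    obtain ⟨i, hi⟩ := h
    rw [Finset.prod_eq_zero (Finset.mem_univ i) (by simp [hi]), mul_zero]
  have h' (i : Fin m) (a : Fin 2) : (s (i, a)).1 = (s (i, 0)).1 := by
    fin_cases a
    · rfl
    · exact (h i).symm
  have hσ : Function.Bijective fun i ↦ (s (i, 0)).1 := by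
    rw [← Finite.surjective_iff_bijective]
    intro j
    obtain ⟨⟨i, a⟩, hi⟩ := s.surjective (j, 0)
    exact ⟨i, by simp only [← h' i a, hi]⟩
  have hf (i : Fin m) : Function.Bijective fun a ↦ (s (i, a)).2 := by
    rw [← Finite.injective_iff_bijective]
    intro a b hab
    have : s (i, a) = s (i, b) := Prod.ext ((h' i a).trans (h' i b).symm) hab
    simpa using s.injective this
  let σ : Equiv.Perm (Fin m) := Equiv.ofBijective _ hσ
  let f (i : Fin m) : Equiv.Perm (Fin 2) := Equiv.ofBijective _ (hf i)
  have hs : s = Equiv.prodCongrLeft (fun _ : Fin 2 ↦ σ) * Equiv.prodCongrRight f := by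
    ext ⟨i, a⟩ : 1
    exact Prod.ext (h' i a) rfl
  have hsign : ((Equiv.Perm.sign s : ℤ) : ℝ) = ∏ i, ((Equiv.Perm.sign (f i) : ℤ) : ℝ) := by
    conv_lhs => rw [hs]
    rw [Equiv.Perm.sign_mul, Equiv.Perm.sign_prodCongrLeft, Equiv.Perm.sign_prodCongrRight,
      Fin.prod_univ_two, Int.units_mul_self, one_mul]
    push_cast
    rfl
  have hp (g : Equiv.Perm (Fin 2)) : planeForm (g 0) (g 1) = ((Equiv.Perm.sign g : ℤ) : ℝ) := by
    have : ∀ g : Equiv.Perm (Fin 2), (if g 0 = g 1 then 0 else if g 0 = 0 then 1 else -1 : ℤ)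
        = Equiv.Perm.sign g := by decide
    rw [← this g, planeForm]
    push_cast
    rfl
  rw [hsign, ← Finset.prod_mul_distrib]
  refine Finset.prod_nonneg fun i _ ↦ ?_
  rw [if_pos (h i)]
  change 0 ≤ _ * planeForm (f i 0) (f i 1)
  rw [hp]
  exact mul_self_nonneg _

/-- The top power of a nondegenerate alternating form does not vanish. -/
lemma exists_altPower_ne_zero (m : ℕ) [FiniteDimensional ℝ V]
    (hV : Module.finrank ℝ V = 2 * m) (B : V →ₗ[ℝ] V →ₗ[ℝ] ℝ)
    (hB : ∀ u, B u u = 0) (hnd : ∀ u, (∀ w, B u w = 0) → u = 0) :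
    ∃ e, altPower m B e ≠ 0 := by
  obtain ⟨e, he⟩ := exists_symplectic_family m hV B hB hnd
  refine ⟨e, ne_of_gt ?_⟩
  rw [altPower_apply]
  simp only [he]
  refine Finset.sum_pos' (fun s _ ↦ sign_mul_prod_planeForm_nonneg m s)
    ⟨1, Finset.mem_univ _, ?_⟩
  simp [planeForm]

/-- An endomorphism acts on a top-degree form as a derivation by its trace. -/
lemma sum_update_eq_trace_mul {ι : Type*} [Fintype ι] [DecidableEq ι] [FiniteDimensional ℝ V]
    (hV : Module.finrank ℝ V = Fintype.card ι) (Φ : V [⋀^ι]→ₗ[ℝ] ℝ) (v : ι → V) (hv : Φ v ≠ 0)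
    (A : Module.End ℝ V) :
    ∑ i, Φ (Function.update v i (A (v i))) = LinearMap.trace ℝ V A * Φ v := by
  have hli : LinearIndependent ℝ v := by
    by_contra h
    exact hv (Φ.map_linearDependent v h)
  let b : Module.Basis ι ℝ V := Module.Basis.mk hli (by
    rw [top_le_iff]; exact hli.span_eq_top_of_card_eq_finrank' hV.symm)
  have hb (i) : b i = v i := by simp [b]
  rw [LinearMap.trace_eq_matrix_trace ℝ b, Matrix.trace, Finset.sum_mul]
  refine Finset.sum_congr rfl fun i _ ↦ ?_
  rw [Matrix.diag_apply, LinearMap.toMatrix_apply]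
  have e : A (v i) = ∑ j, b.repr (A (v i)) j • v j := by
    conv_lhs => rw [← b.sum_repr (A (v i))]
    simp [hb]
  conv_lhs => rw [e]
  rw [← AlternatingMap.coe_multilinearMap, MultilinearMap.map_update_sum]
  rw [Finset.sum_eq_single i]
  · rw [MultilinearMap.map_update_smul, Function.update_eq_self, smul_eq_mul, hb]
  · intro j _ hj
    rw [MultilinearMap.map_update_smul, AlternatingMap.coe_multilinearMap,
      Φ.map_update_self _ hj.symm, smul_zero]
  · simp
end TopPower

/-! ### Pointwise calculus of connections -/

section Calculus

variable {n : ℕ} {M : Type*} [TopologicalSpace M]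
  [ChartedSpace (EuclideanSpace ℝ (Fin (4 * n))) M]

instance (x : M) : FiniteDimensional ℝ (TangentSpace (𝓡 (4 * n)) x) :=
  inferInstanceAs (FiniteDimensional ℝ (EuclideanSpace ℝ (Fin (4 * n))))

instance (x : M) : T2Space (TangentSpace (𝓡 (4 * n)) x) :=
  inferInstanceAs (T2Space (EuclideanSpace ℝ (Fin (4 * n))))

lemma finrank_tangentSpace (x : M) : Module.finrank ℝ (TangentSpace (𝓡 (4 * n)) x) = 4 * n :=
  finrank_euclideanSpace_fin (𝕜 := ℝ) (n := 4 * n)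

variable [IsManifold (𝓡 (4 * n)) ∞ M]

lemma exists_diffAt (x : M) (v : TangentSpace (𝓡 (4 * n)) x) :
    ∃ X : VField n M, DiffAt n X x ∧ X x = v :=
  ⟨FiberBundle.extend (EuclideanSpace ℝ (Fin (4 * n))) v,
    FiberBundle.mdifferentiableAt_extend .., FiberBundle.extend_apply_self ..⟩

variable {x : M} {X Y : VField n M} {σ : EndField n M} {U : Set M} {θ : FormField n M}

lemma DiffAt.add (hX : DiffAt n X x) (hY : DiffAt n Y x) : DiffAt n (X + Y) x :=
  mdifferentiableAt_add_section hX hY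

lemma DiffAt.sub (hX : DiffAt n X x) (hY : DiffAt n Y x) : DiffAt n (X - Y) x :=
  mdifferentiableAt_sub_section hX hY

lemma DiffAt.smul {f : M → ℝ} (hf : MDifferentiableAt (𝓡 (4 * n)) 𝓘(ℝ, ℝ) f x)
    (hX : DiffAt n X x) : DiffAt n (f • X) x :=
  MDifferentiableAt.smul_section hf hX

lemma SmoothEndOn.diffAt (hσ : SmoothEndOn n σ U) (hU : IsOpen U) (hx : x ∈ U)
    (hX : DiffAt n X x) : DiffAt n (fun y ↦ σ y (X y)) x :=
  MDifferentiableAt.clm_bundle_apply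
    (((hσ x hx).contMDiffAt (hU.mem_nhds hx)).mdifferentiableAt (by simp)) hX

lemma SmoothForm.mdifferentiableAt (hθ : SmoothForm n θ)
    (hX : DiffAt n X x) (hY : DiffAt n Y x) :
    MDifferentiableAt (𝓡 (4 * n)) 𝓘(ℝ, ℝ) (fun y ↦ θ y (X y) (Y y)) x := by
  have := MDifferentiableAt.clm_bundle_apply₂ (F₃ := ℝ) (E₃ := fun _ ↦ ℝ)
    ((hθ x).mdifferentiableAt (by simp)) hX hY
  rw [mdifferentiableAt_totalSpace] at this
  exact this.2

lemma conn_congr (D : Conn n M) (hX : DiffAt n X x) (hY : DiffAt n Y x)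
    (h : ∀ᶠ y in 𝓝 x, X y = Y y) : D X x = D Y x :=
  D.isCovariantDerivativeOnUniv.congr_of_eventuallyEq hX hY Filter.univ_mem h

lemma conn_add (D : Conn n M) (hX : DiffAt n X x) (hY : DiffAt n Y x) :
    D (X + Y) x = D X x + D Y x :=
  D.isCovariantDerivativeOnUniv.add hX hY

lemma conn_smul (D : Conn n M) {f : M → ℝ}
    (hf : MDifferentiableAt (𝓡 (4 * n)) 𝓘(ℝ, ℝ) f x) (hX : DiffAt n X x)
    (v : TangentSpace (𝓡 (4 * n)) x) :
    D (f • X) x v = f x • D X x v + mvfderiv (𝓡 (4 * n)) f x v • X x := by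
  rw [D.isCovariantDerivativeOnUniv.leibniz hX hf]
  rfl

lemma conn_sub (D : Conn n M) (hX : DiffAt n X x) (hY : DiffAt n Y x) :
    D (X - Y) x = D X x - D Y x := by
  have := conn_add D (hX.sub hY) hY
  rw [sub_add_cancel] at this
  rw [this, add_sub_cancel_right]

lemma conn_sum (D : Conn n M) {ι : Type*} (s : Finset ι) (Z : ι → VField n M)
    (hZ : ∀ i ∈ s, DiffAt n (Z i) x) :
    DiffAt n (fun y ↦ ∑ i ∈ s, Z i y) x ∧ D (fun y ↦ ∑ i ∈ s, Z i y) x = ∑ i ∈ s, D (Z i) x := by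
  classical
  induction s using Finset.induction_on with
  | empty =>
    have h : (fun y ↦ ∑ i ∈ (∅ : Finset ι), Z i y : VField n M) = 0 := by ext1 y; simp
    rw [h]
    exact ⟨Bundle.mdifferentiableAt_zeroSection .., by
      rw [D.isCovariantDerivativeOnUniv.zero]; simp⟩
  | insert i s hi ih =>
    have h : (fun y ↦ ∑ j ∈ insert i s, Z j y : VField n M) = Z i + fun y ↦ ∑ j ∈ s, Z j y := by
      ext1 y; simp [Finset.sum_insert hi]
    have hi' := hZ i (Finset.mem_insert_self i s)
    have ih' := ih fun j hj ↦ hZ j (Finset.mem_insert_of_mem hj)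
    rw [h, Finset.sum_insert hi, conn_add D hi' ih'.1, ih'.2]
    exact ⟨hi'.add ih'.1, rfl⟩

lemma bracket_eq (D : Conn n M) (hD : D.torsion = 0) (hX : DiffAt n X x) (hY : DiffAt n Y x) :
    VectorField.mlieBracket (𝓡 (4 * n)) X Y x = D Y x (X x) - D X x (Y x) :=
  (D.torsion_eq_zero_iff.mp hD hX hY).symm

end Calculus

/-! ### Torsion-free connections preserving a quaternionic structure -/

section Quaternionic

variable {n : ℕ} {M : Type*} [TopologicalSpace M]
  [ChartedSpace (EuclideanSpace ℝ (Fin (4 * n))) M]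

/-- The bilinear map `(u, w) ↦ nijenhuisForm J q u w`, with continuity built in. -/
def nijenhuisTensor {x : M}
    (J : TangentSpace (𝓡 (4 * n)) x →L[ℝ] TangentSpace (𝓡 (4 * n)) x)
    (q : TangentSpace (𝓡 (4 * n)) x →ₗ[ℝ] Module.End ℝ (TangentSpace (𝓡 (4 * n)) x)) :
    TangentSpace (𝓡 (4 * n)) x →L[ℝ] TangentSpace (𝓡 (4 * n)) x →L[ℝ]
      TangentSpace (𝓡 (4 * n)) x :=
  LinearMap.toContinuousLinearMap (LinearMap.toContinuousLinearMap.toLinearMap ∘ₗ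
    LinearMap.mk₂ ℝ (nijenhuisForm J.toLinearMap q)
      (fun u u' w ↦ by simp [nijenhuisForm]; abel)
      (fun c u w ↦ by simp [nijenhuisForm]; module)
      (fun u w w' ↦ by simp [nijenhuisForm]; abel)
      (fun c u w ↦ by simp [nijenhuisForm]; module))

lemma nijenhuisTensor_apply {x : M}
    (J : TangentSpace (𝓡 (4 * n)) x →L[ℝ] TangentSpace (𝓡 (4 * n)) x)
    (q : TangentSpace (𝓡 (4 * n)) x →ₗ[ℝ] Module.End ℝ (TangentSpace (𝓡 (4 * n)) x))
    (u w : TangentSpace (𝓡 (4 * n)) x) :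
    nijenhuisTensor J q u w = nijenhuisForm J.toLinearMap q u w := rfl

variable [IsManifold (𝓡 (4 * n)) ∞ M]

/-- The covariant derivative at `x` of the field of endomorphisms `σ` is `v ↦ q v`. -/
def HasCovDeriv (D : Conn n M) (σ : EndField n M) (x : M)
    (q : TangentSpace (𝓡 (4 * n)) x →ₗ[ℝ] Module.End ℝ (TangentSpace (𝓡 (4 * n)) x)) : Prop :=
  ∀ Y : VField n M, DiffAt n Y x → DiffAt n (fun y ↦ σ y (Y y)) x ∧
    ∀ v, D (fun y ↦ σ y (Y y)) x v = σ x (D Y x v) + q v (Y x)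

variable {D : Conn n M} {σ τ : EndField n M} {x : M}
  {q r : TangentSpace (𝓡 (4 * n)) x →ₗ[ℝ] Module.End ℝ (TangentSpace (𝓡 (4 * n)) x)}

lemma HasCovDeriv.comp (hσ : HasCovDeriv D σ x q) (hτ : HasCovDeriv D τ x r)
    {ρ : EndField n M} (hρ : ∀ᶠ y in 𝓝 x, ∀ u, ρ y u = σ y (τ y u))
    {p : TangentSpace (𝓡 (4 * n)) x →ₗ[ℝ] Module.End ℝ (TangentSpace (𝓡 (4 * n)) x)}
    (hp : HasCovDeriv D ρ x p) (v : TangentSpace (𝓡 (4 * n)) x) :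
    q v * (τ x).toLinearMap + (σ x).toLinearMap * r v = p v := by
  ext u
  obtain ⟨Y, hY, rfl⟩ := exists_diffAt x u
  obtain ⟨h1, h2⟩ := hτ Y hY
  obtain ⟨h3, h4⟩ := hσ _ h1
  obtain ⟨h5, h6⟩ := hp Y hY
  have e := congr($(conn_congr D h5 h3 (hρ.mono fun y hy ↦ hy _)) v)
  rw [h6, h4, h2, hρ.self_of_nhds, map_add] at e
  simp only [LinearMap.add_apply, Module.End.mul_apply, ContinuousLinearMap.coe_coe]
  rw [add_assoc, add_right_inj] at e
  rw [e, add_comm]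

lemma HasCovDeriv.neg (hσ : HasCovDeriv D σ x q) : HasCovDeriv D (-σ) x (-q) := by
  intro Y hY
  obtain ⟨h1, h2⟩ := hσ Y hY
  have e : (fun y ↦ (-σ) y (Y y) : VField n M) = 0 - fun y ↦ σ y (Y y) := by
    ext1 y; simp
  have z : DiffAt n (0 : VField n M) x := Bundle.mdifferentiableAt_zeroSection ..
  rw [e, conn_sub D z h1, D.isCovariantDerivativeOnUniv.zero]
  refine ⟨z.sub h1, fun v ↦ ?_⟩
  simp [h2]
  abel

lemma hasCovDeriv_neg_id (D : Conn n M) (x : M) :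
    HasCovDeriv D (fun _ ↦ -ContinuousLinearMap.id ℝ _) x 0 := by
  have : HasCovDeriv D (fun _ ↦ ContinuousLinearMap.id ℝ _) x 0 := fun Y hY ↦ ⟨hY, by simp⟩
  have h := this.neg
  rw [neg_zero] at h
  exact h

lemma PreservesQ.exists_hasCovDeriv {Q : EndSubspaceField n M} (hD : PreservesQ n D Q)
    {U : Set M} (hU : IsOpen U) (hσ : SmoothEndOn n σ U) (hQ : ∀ y ∈ U, σ y ∈ Q y) (hx : x ∈ U) :
    ∃ q, HasCovDeriv D σ x q ∧ ∀ v, ∃ q' ∈ Q x, q v = q'.toLinearMap := by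
  choose q' hq' h using hD U σ hU hσ hQ x hx
  have hl (v) (Y : VField n M) (hY : DiffAt n Y x) :
      q' v (Y x) = D (fun y ↦ σ y (Y y)) x v - σ x (D Y x v) := (h v Y hY).symm
  refine ⟨{ toFun := fun v ↦ (q' v).toLinearMap, map_add' := ?_, map_smul' := ?_ }, ?_,
    fun v ↦ ⟨q' v, hq' v, rfl⟩⟩
  · intro v w
    ext u
    obtain ⟨Y, hY, rfl⟩ := exists_diffAt x u
    simp only [ContinuousLinearMap.coe_coe, LinearMap.add_apply, hl _ Y hY, map_add]
    abel
  · intro c v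
    ext u
    obtain ⟨Y, hY, rfl⟩ := exists_diffAt x u
    simp only [ContinuousLinearMap.coe_coe, LinearMap.smul_apply, hl _ Y hY, map_smul,
      RingHom.id_apply, smul_sub]
  · intro Y hY
    refine ⟨hσ.diffAt hU hx hY, fun v ↦ ?_⟩
    change _ = _ + q' v (Y x)
    rw [hl v Y hY]
    abel

variable {Q : EndSubspaceField n M} {U : Set M} {J : Fin 3 → EndField n M}

lemma IsAdmissibleBasis.triple (hJ : IsAdmissibleBasis n Q U J) (hx : x ∈ U) :
    IsQuaternionTriple (J 0 x).toLinearMap (J 1 x).toLinearMap (J 2 x).toLinearMap where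
  II := by ext u; simpa using hJ.sq x hx 0 u
  JJ := by ext u; simpa using hJ.sq x hx 1 u
  IJ := by ext u; simpa using hJ.mul x hx u
  JI := by ext u; simpa using hJ.anti x hx u

lemma IsAdmissibleBasis.mem (hJ : IsAdmissibleBasis n Q U J) (hx : x ∈ U) (a : Fin 3) :
    J a x ∈ Q x := by
  rw [hJ.span x hx]; exact Submodule.subset_span ⟨a, rfl⟩

lemma IsAdmissibleBasis.exists_eq (hJ : IsAdmissibleBasis n Q U J) (hx : x ∈ U)
    {q : TangentSpace (𝓡 (4 * n)) x →L[ℝ] TangentSpace (𝓡 (4 * n)) x} (hq : q ∈ Q x) :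
    ∃ a b c : ℝ, q = a • J 0 x + b • J 1 x + c • J 2 x := by
  rw [hJ.span x hx, Submodule.mem_span_range_iff_exists_fun] at hq
  obtain ⟨c, rfl⟩ := hq
  exact ⟨c 0, c 1, c 2, by rw [Fin.sum_univ_three]⟩

lemma IsAdmissibleBasis.mem_span (hJ : IsAdmissibleBasis n Q U J) (hx : x ∈ U)
    {q : TangentSpace (𝓡 (4 * n)) x →L[ℝ] TangentSpace (𝓡 (4 * n)) x} (hq : q ∈ Q x) :
    q.toLinearMap ∈
      Submodule.span ℝ {(J 0 x).toLinearMap, (J 1 x).toLinearMap, (J 2 x).toLinearMap} := by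
  obtain ⟨a, b, c, rfl⟩ := hJ.exists_eq hx hq
  exact Submodule.mem_span_triple.mpr ⟨a, b, c, rfl⟩

/-- A torsion-free connection computes the Nijenhuis tensor of an almost complex structure. -/
lemma HasCovDeriv.isNijenhuisAt (hD : D.torsion = 0) (hσ : HasCovDeriv D σ x q)
    (hsq : ∀ u, σ x (σ x u) = -u) : IsNijenhuisAt n σ x (nijenhuisTensor (σ x) q) := by
  intro X Y hX hY
  obtain ⟨h1, h2⟩ := hσ X hX
  obtain ⟨h3, h4⟩ := hσ Y hY
  rw [bracket_eq D hD h1 h3, bracket_eq D hD h1 hY, bracket_eq D hD hX h3, bracket_eq D hD hX hY,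
    nijenhuisTensor_apply, nijenhuisForm, h2, h4, h2, h4]
  simp only [map_sub, map_add, hsq, ContinuousLinearMap.coe_coe]
  abel

lemma IsNijenhuisAt.unique {S T : TangentSpace (𝓡 (4 * n)) x →L[ℝ]
      TangentSpace (𝓡 (4 * n)) x →L[ℝ] TangentSpace (𝓡 (4 * n)) x}
    (hS : IsNijenhuisAt n σ x S) (hT : IsNijenhuisAt n σ x T) : S = T := by
  ext1 u
  ext1 w
  obtain ⟨X, hX, rfl⟩ := exists_diffAt x u
  obtain ⟨Y, hY, rfl⟩ := exists_diffAt x w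
  rw [hS X Y hX hY, hT X Y hX hY]

/-- If `Q` is preserved by a torsion-free connection, then the torsion prescribed for the Oproiu
connection is zero. -/
lemma oproiu_torsion_eq_zero (hn : 1 ≤ n) (hDQ : PreservesQ n D Q) (hD : D.torsion = 0)
    (hJ : IsAdmissibleBasis n Q U J) (hx : x ∈ U) :
    ∃ N : Fin 3 → (TangentSpace (𝓡 (4 * n)) x →L[ℝ] TangentSpace (𝓡 (4 * n)) x →L[ℝ]
        TangentSpace (𝓡 (4 * n)) x),
      (∀ a, IsNijenhuisAt n (J a) x (N a)) ∧ ∀ u w : TangentSpace (𝓡 (4 * n)) x,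
        ((1 / 6 : ℝ) • ∑ a, N a) u w + ∑ a,
          (tau n (J a x) ((1 / 6 : ℝ) • ∑ a, N a) u • J a x w
            - tau n (J a x) ((1 / 6 : ℝ) • ∑ a, N a) w • J a x u) = 0 := by
  choose q hq hm using fun a ↦
    hDQ.exists_hasCovDeriv hJ.isOpen (hJ.smooth a) (fun y hy ↦ hJ.mem hy a) hx
  have hU := hJ.isOpen.mem_nhds hx
  have h := hJ.triple hx
  have hd : (Module.finrank ℝ (TangentSpace (𝓡 (4 * n)) x) : ℝ) = 4 * n := by
    rw [finrank_tangentSpace]; push_cast; ring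
  have hn' : (1 : ℝ) ≤ n := by exact_mod_cast hn
  have hm' (a) (v) : q a v ∈ Submodule.span ℝ
      {(J 0 x).toLinearMap, (J 1 x).toLinearMap, (J 2 x).toLinearMap} := by
    obtain ⟨p, hp, e⟩ := hm a v
    rw [e]
    exact hJ.mem_span hx hp
  have hsq (a) (v) : q a v * (J a x).toLinearMap + (J a x).toLinearMap * q a v = 0 :=
    (hq a).comp (hq a) (Filter.mem_of_superset hU fun y hy u ↦ by simp [hJ.sq y hy])
      (hasCovDeriv_neg_id D x) v
  obtain ⟨a, b, c, habc⟩ := h.exists_connection_forms (by rw [hd]; positivity) (q 0) (q 1) (q 2)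
    (hm' 0) (hm' 1) (hm' 2) (hsq 0) (hsq 1)
    ((hq 0).comp (hq 1) (Filter.mem_of_superset hU fun y hy u ↦ (hJ.mul y hy u).symm) (hq 2))
    ((hq 1).comp (hq 0) (Filter.mem_of_superset hU fun y hy u ↦ (hJ.anti y hy u).symm) (hq 2).neg)
  obtain ⟨s₁, s₂, s₃, hN, h₁, h₂, h₃⟩ := h.exists_torsion_forms (q 0) (q 1) (q 2) a b c habc
  refine ⟨fun a ↦ nijenhuisTensor (J a x) (q a),
    fun a ↦ (hq a).isNijenhuisAt hD (fun u ↦ hJ.sq x hx a u), ?_⟩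
  set T := (1 / 6 : ℝ) • ∑ a, nijenhuisTensor (J a x) (q a) with hT
  have hT' (u w) : T u w = (s₁ u • J 0 x w - s₁ w • J 0 x u) + (s₂ u • J 1 x w - s₂ w • J 1 x u)
      + (s₃ u • J 2 x w - s₃ w • J 2 x u) := by
    rw [hT, Fin.sum_univ_three]
    exact hN u w
  have hne : (4 * (n : ℝ) - 2) ≠ 0 := by linarith
  have t₁ (u) : tau n (J 0 x) T u = -s₁ u := by
    have := h.trace_mul_torsion s₁ s₂ s₃ h₁ u (T u).toLinearMap (hT' u)
    rw [hd] at this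
    change _ * LinearMap.trace ℝ _ ((J 0 x).toLinearMap * (T u).toLinearMap) = _
    rw [this]
    field_simp
  have t₂ (u) : tau n (J 1 x) T u = -s₂ u := by
    have := h.rotate.trace_mul_torsion s₂ s₃ s₁ h₂ u (T u).toLinearMap
      (fun w ↦ (hT' u w).trans (by simp only [ContinuousLinearMap.coe_coe]; abel))
    rw [hd] at this
    change _ * LinearMap.trace ℝ _ ((J 1 x).toLinearMap * (T u).toLinearMap) = _
    rw [this]
    field_simp
  have t₃ (u) : tau n (J 2 x) T u = -s₃ u := by
    have := h.rotate.rotate.trace_mul_torsion s₃ s₁ s₂ h₃ u (T u).toLinearMap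
      (fun w ↦ (hT' u w).trans (by simp only [ContinuousLinearMap.coe_coe]; abel))
    rw [hd] at this
    change _ * LinearMap.trace ℝ _ ((J 2 x).toLinearMap * (T u).toLinearMap) = _
    rw [this]
    field_simp
  intro u w
  rw [hT', Fin.sum_univ_three]
  simp only [t₁, t₂, t₃]
  module

end Quaternionic

/-! ### The volume form and the canonical connections of a torsion-free structure -/

section Volume

variable {n : ℕ} {M : Type*} [TopologicalSpace M]
  [ChartedSpace (EuclideanSpace ℝ (Fin (4 * n))) M]

/-- The function `f` is differentiable at `x` with derivative `c` in the direction `v`. -/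
def HasDirDeriv (f : M → ℝ) (x : M) (v : TangentSpace (𝓡 (4 * n)) x) (c : ℝ) : Prop :=
  MDifferentiableAt (𝓡 (4 * n)) 𝓘(ℝ, ℝ) f x ∧ mvfderiv (𝓡 (4 * n)) f x v = c

lemma HasDirDeriv.mul {f g : M → ℝ} {x : M} {v : TangentSpace (𝓡 (4 * n)) x} {c d : ℝ}
    (hf : HasDirDeriv f x v c) (hg : HasDirDeriv g x v d) :
    HasDirDeriv (fun y ↦ f y * g y) x v (f x * d + g x * c) := by
  have := mvfderiv_mul hf.1 hg.1
  refine ⟨hf.1.mul hg.1, ?_⟩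
  change mvfderiv (𝓡 (4 * n)) (f * g) x v = _
  rw [this]
  simp [hf.2, hg.2]

lemma HasDirDeriv.add {f g : M → ℝ} {x : M} {v : TangentSpace (𝓡 (4 * n)) x} {c d : ℝ}
    (hf : HasDirDeriv f x v c) (hg : HasDirDeriv g x v d) :
    HasDirDeriv (fun y ↦ f y + g y) x v (c + d) := by
  have := mvfderiv_add hf.1 hg.1
  refine ⟨hf.1.add hg.1, ?_⟩
  change mvfderiv (𝓡 (4 * n)) (f + g) x v = _
  rw [this]
  simp [hf.2, hg.2]

lemma hasDirDeriv_const (x : M) (v : TangentSpace (𝓡 (4 * n)) x) (c : ℝ) :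
    HasDirDeriv (fun _ ↦ c) x v 0 :=
  ⟨mdifferentiableAt_const, by rw [mvfderiv_const]; rfl⟩

lemma HasDirDeriv.const_mul {f : M → ℝ} {x : M} {v : TangentSpace (𝓡 (4 * n)) x} {c : ℝ}
    (a : ℝ) (hf : HasDirDeriv f x v c) : HasDirDeriv (fun y ↦ a * f y) x v (a * c) := by
  simpa using (hasDirDeriv_const x v a).mul hf

lemma HasDirDeriv.sum {ι : Type*} (s : Finset ι) {f : ι → M → ℝ} {x : M}
    {v : TangentSpace (𝓡 (4 * n)) x} {c : ι → ℝ} (hf : ∀ i, HasDirDeriv (f i) x v (c i)) :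
    HasDirDeriv (fun y ↦ ∑ i ∈ s, f i y) x v (∑ i ∈ s, c i) := by
  classical
  induction s using Finset.induction_on with
  | empty => simpa using hasDirDeriv_const x v 0
  | insert i s hi ih => simpa only [Finset.sum_insert hi] using (hf i).add ih

lemma HasDirDeriv.prod {ι : Type*} [DecidableEq ι] (s : Finset ι) {f : ι → M → ℝ} {x : M}
    {v : TangentSpace (𝓡 (4 * n)) x} {c : ι → ℝ} (hf : ∀ i, HasDirDeriv (f i) x v (c i)) :
    HasDirDeriv (fun y ↦ ∏ i ∈ s, f i y) x v (∑ i ∈ s, c i * ∏ j ∈ s.erase i, f j x) := by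
  induction s using Finset.induction_on with
  | empty => simpa using hasDirDeriv_const x v 1
  | insert i s hi ih =>
    simp only [Finset.prod_insert hi, Finset.sum_insert hi, Finset.erase_insert hi]
    convert (hf i).mul ih using 1
    rw [add_comm, mul_comm (c i), Finset.mul_sum]
    congr 1
    refine Finset.sum_congr rfl fun j hj ↦ ?_
    have hij : i ≠ j := fun h ↦ hi (h ▸ hj)
    rw [Finset.erase_insert_of_ne hij, Finset.prod_insert (by simp [hi])]
    ring

variable [IsManifold (𝓡 (4 * n)) ∞ M]

variable {D : Conn n M} {θ : FormField n M} {Q : EndSubspaceField n M}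

/-- The value at a point of a field of bilinear forms, with the continuity forgotten. -/
def bilin (θ : FormField n M) (x : M) :
    TangentSpace (𝓡 (4 * n)) x →ₗ[ℝ] TangentSpace (𝓡 (4 * n)) x →ₗ[ℝ] ℝ :=
  ContinuousLinearMap.coeLM ℝ ∘ₗ (θ x).toLinearMap

omit [IsManifold (𝓡 (4 * n)) ∞ M] in
lemma vol_eq (θ : FormField n M) (x : M) (v : Fin (2 * n) × Fin 2 → TangentSpace (𝓡 (4 * n)) x) :
    vol n θ x v = (1 / 2 ^ (2 * n) : ℝ) * altPower (2 * n) (bilin θ x) v := by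
  rw [altPower_apply]
  rfl

/-- A connection preserving a form preserves its exterior powers. -/
lemma PreservesForm.preservesVol (hθ : SmoothForm n θ) (hD : PreservesForm n D θ) :
    PreservesVol n D (vol n θ) := by
  intro x v Y hY
  have h (p q : Fin (2 * n) × Fin 2) : HasDirDeriv (fun y ↦ θ y (Y p y) (Y q y)) x v
      (θ x (D (Y p) x v) (Y q x) + θ x (Y p x) (D (Y q) x v)) := by
    refine ⟨hθ.mdifferentiableAt (hY p) (hY q), ?_⟩
    have := hD x v (Y p) (Y q) (hY p) (hY q)
    rw [covForm] at this
    linarith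
  have key := (HasDirDeriv.sum Finset.univ fun s : Equiv.Perm (Fin (2 * n) × Fin 2) ↦
    (HasDirDeriv.prod Finset.univ fun i ↦ h (s (i, 0)) (s (i, 1))).const_mul
      ((Equiv.Perm.sign s : ℤ) : ℝ)).const_mul (1 / 2 ^ (2 * n) : ℝ)
  refine key.2.trans ?_
  simp only [vol, wedgePow]
  rw [← Finset.mul_sum, Finset.sum_comm]
  congr 1
  refine Finset.sum_congr rfl fun s _ ↦ ?_
  rw [← Finset.mul_sum]
  congr 1
  rw [← Equiv.sum_comp s, Fintype.sum_prod_type]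
  refine Finset.sum_congr rfl fun i _ ↦ ?_
  rw [Fin.sum_univ_two]
  have aux (a : Fin 2) (z : TangentSpace (𝓡 (4 * n)) x) :
      ∏ j ∈ Finset.univ.erase i, θ x (Function.update (fun j ↦ Y j x) (s (i, a)) z (s (j, 0)))
        (Function.update (fun j ↦ Y j x) (s (i, a)) z (s (j, 1)))
      = ∏ j ∈ Finset.univ.erase i, θ x (Y (s (j, 0)) x) (Y (s (j, 1)) x) := by
    refine Finset.prod_congr rfl fun j hj ↦ ?_
    have hj := Finset.ne_of_mem_erase hj
    rw [Function.update_of_ne, Function.update_of_ne] <;> simp [hj]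
  simp only [← Finset.mul_prod_erase _ _ (Finset.mem_univ i), aux]
  rw [Function.update_self, Function.update_self, Function.update_of_ne (by simp),
    Function.update_of_ne (by simp)]
  ring

lemma IsAlmostQSH.exists_vol_ne_zero (h : IsAlmostQSH n Q θ) (x : M) :
    ∃ e, altPower (2 * n) (bilin θ x) e ≠ 0 :=
  exists_altPower_ne_zero (2 * n) ((finrank_tangentSpace x).trans (by ring)) (bilin θ x)
    (h.alternating x) (h.nondegenerate x)

/-- The difference `D' - D` of two connections at a point, as the linear map
`v ↦ (w ↦ D'_v w - D_v w)`. -/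
lemma exists_difference (D D' : Conn n M) (x : M) :
    ∃ A : TangentSpace (𝓡 (4 * n)) x →ₗ[ℝ] Module.End ℝ (TangentSpace (𝓡 (4 * n)) x),
      ∀ (v) (Y : VField n M), DiffAt n Y x → A v (Y x) = D' Y x v - D Y x v := by
  let B := D'.isCovariantDerivativeOnUniv.difference D.isCovariantDerivativeOnUniv x
  refine ⟨(ContinuousLinearMap.coeLM ℝ ∘ₗ B.toLinearMap).flip, fun v Y hY ↦ ?_⟩
  have := IsCovariantDerivativeOn.difference_apply D'.isCovariantDerivativeOnUniv
    D.isCovariantDerivativeOnUniv (mem_univ x) hY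
  exact congr($this v)

/-- A torsion-free connection preserving `Q` and the volume form `θ^{2n}` is unique. -/
lemma sameConn_of_preserves (hn : 1 ≤ n) (h : IsAlmostQSH n Q θ) {D D' : Conn n M}
    (hQ : PreservesQ n D Q) (hQ' : PreservesQ n D' Q) (hv : PreservesVol n D (vol n θ))
    (hv' : PreservesVol n D' (vol n θ)) (ht : D.torsion = 0) (ht' : D'.torsion = 0) :
    SameConn n D' D := by
  intro x Y hY
  obtain ⟨A, hA⟩ := exists_difference D D' x
  suffices A = 0 by
    ext1 v
    have e := hA v Y hY
    rw [this] at e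
    exact (sub_eq_zero.mp e.symm)
  obtain ⟨U, J, hx, hJ⟩ := h.quaternionic x
  have hcomm (a : Fin 3) (v) : A v * (J a x).toLinearMap - (J a x).toLinearMap * A v ∈
      Submodule.span ℝ {(J 0 x).toLinearMap, (J 1 x).toLinearMap, (J 2 x).toLinearMap} := by
    obtain ⟨q, hq, hm⟩ := hQ.exists_hasCovDeriv hJ.isOpen (hJ.smooth a)
      (fun y hy ↦ hJ.mem hy a) hx
    obtain ⟨q', hq', hm'⟩ := hQ'.exists_hasCovDeriv hJ.isOpen (hJ.smooth a)
      (fun y hy ↦ hJ.mem hy a) hx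
    have e : A v * (J a x).toLinearMap - (J a x).toLinearMap * A v = q' v - q v := by
      ext u
      obtain ⟨Z, hZ, rfl⟩ := exists_diffAt x u
      obtain ⟨h1, h2⟩ := hq Z hZ
      obtain ⟨_, h4⟩ := hq' Z hZ
      have e := hA v _ h1
      simp only [LinearMap.sub_apply, Module.End.mul_apply, ContinuousLinearMap.coe_coe]
      rw [e, h2, h4, hA v Z hZ, map_sub]
      abel
    obtain ⟨p, hp, e1⟩ := hm v
    obtain ⟨p', hp', e2⟩ := hm' v
    rw [e, e1, e2]
    exact Submodule.sub_mem _ (hJ.mem_span hx hp') (hJ.mem_span hx hp)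
  refine (hJ.triple hx).prolongation_eq_zero (by rw [finrank_tangentSpace]; omega) A ?_ ?_
    (hcomm 0) (hcomm 1) (hcomm 2)
  · intro u w
    obtain ⟨X, hX, rfl⟩ := exists_diffAt x u
    obtain ⟨Z, hZ, rfl⟩ := exists_diffAt x w
    have e := (bracket_eq D ht hX hZ).symm.trans (bracket_eq D' ht' hX hZ)
    rw [hA _ _ hZ, hA _ _ hX]
    rw [sub_eq_sub_iff_add_eq_add] at e ⊢
    exact e.symm.trans (add_comm _ _)
  · intro v
    obtain ⟨e, he⟩ := h.exists_vol_ne_zero x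
    choose Z hZ hZe using fun i ↦ exists_diffAt x (e i)
    have hcard : Module.finrank ℝ (TangentSpace (𝓡 (4 * n)) x)
        = Fintype.card (Fin (2 * n) × Fin 2) := by
      rw [finrank_tangentSpace]; simp; ring
    have tr := sum_update_eq_trace_mul hcard (altPower (2 * n) (bilin θ x)) e he (A v)
    have e1 := (hv x v Z hZ).symm.trans (hv' x v Z hZ)
    simp only [vol_eq, hZe, ← Finset.mul_sum] at e1
    rw [mul_right_inj' (by positivity)] at e1
    have e2 (i) : altPower (2 * n) (bilin θ x) (Function.update e i (A v (e i)))
        = altPower (2 * n) (bilin θ x) (Function.update e i (D' (Z i) x v))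
          - altPower (2 * n) (bilin θ x) (Function.update e i (D (Z i) x v)) := by
      rw [← AlternatingMap.map_update_sub, ← hA v _ (hZ i), hZe]
    rw [Finset.sum_congr rfl fun i _ ↦ e2 i, Finset.sum_sub_distrib, e1, sub_self] at tr
    exact (mul_eq_zero.mp tr.symm).resolve_right he

/-- On a torsion-free structure every Oproiu connection is torsion-free, because the prescribed
torsion depends on `Q` only. -/
lemma IsOproiu.torsion_eq_zero (hn : 1 ≤ n) (h : IsAlmostQSH n Q θ) (hQ : PreservesQ n D Q)
    (ht : D.torsion = 0) {μ} {D' : Conn n M} (h' : IsOproiu n Q μ D') : D'.torsion = 0 := by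
  ext1 x
  ext1 u
  ext1 w
  obtain ⟨U, J, hx, hJ⟩ := h.quaternionic x
  obtain ⟨N, hN, hz⟩ := oproiu_torsion_eq_zero hn hQ ht hJ hx
  obtain ⟨N', TH, hN', rfl, hT⟩ := h'.torsion_eq U J hJ x hx
  obtain rfl : N' = N := funext fun a ↦ (hN' a).unique (hN a)
  rw [hT, hz]
  rfl

/-- A torsion-free connection adapted to `(Q, θ)` is the unimodular Oproiu connection. -/
lemma isTheConn_isOproiu (hn : 1 ≤ n) (h : IsAlmostQSH n Q θ)
    (hs : CovariantDerivative.ContMDiffCovariantDerivative D ∞)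
    (hQ : PreservesQ n D Q) (hθ : PreservesForm n D θ) (ht : D.torsion = 0) :
    IsTheConn n (IsOproiu n Q (vol n θ)) D := by
  have hv := hθ.preservesVol h.smooth
  refine ⟨⟨hs, hQ, hv, fun U J hJ x hx ↦ ?_⟩, fun D' h' ↦ ?_⟩
  · obtain ⟨N, hN, hz⟩ := oproiu_torsion_eq_zero hn hQ ht hJ hx
    exact ⟨N, _, hN, rfl, fun u w ↦ by rw [hz, ht]; rfl⟩
  · exact sameConn_of_preserves hn h hQ h'.preservesQ hv h'.preservesVol ht
      (h'.torsion_eq_zero hn h hQ ht)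

/-- A torsion-free connection adapted to `(Q, θ)` is the minimal adapted connection. -/
lemma isTheConn_isMinimalAdapted (hn : 1 ≤ n) (h : IsAlmostQSH n Q θ)
    (hs : CovariantDerivative.ContMDiffCovariantDerivative D ∞)
    (hQ : PreservesQ n D Q) (hθ : PreservesForm n D θ) (ht : D.torsion = 0) :
    IsTheConn n (IsMinimalAdapted n Q θ) D := by
  obtain ⟨h1, h2⟩ := isTheConn_isOproiu hn h hs hQ hθ ht
  refine ⟨⟨hs, D, h1, fun x v Y Z hY hZ ↦ ?_⟩, ?_⟩
  · rw [hθ x v Y Z hY hZ, sub_self, map_zero]; simp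
  · rintro D'' ⟨_, D', hD', hA⟩ x Y hY
    have e := h2 D' hD' x
    ext1 v
    rw [← e Y hY]
    refine sub_eq_zero.mp (h.nondegenerate x _ fun w ↦ ?_)
    obtain ⟨Z, hZ, rfl⟩ := exists_diffAt x w
    have := hθ x v Y Z hY hZ
    rw [covForm] at this
    rw [hA x v Y Z hY hZ, covForm, e Y hY, e Z hZ, this, mul_zero]

/-- A form preserved by a torsion-free connection is closed. -/
lemma PreservesForm.isClosedForm (hθ : PreservesForm n D θ) (ht : D.torsion = 0)
    (halt : ∀ (x : M) (u : TangentSpace (𝓡 (4 * n)) x), θ x u u = 0) : IsClosedForm n θ := by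
  intro x X Y Z hX hY hZ
  have hskew (u w : TangentSpace (𝓡 (4 * n)) x) : θ x u w = -θ x w u := by
    have := halt x (u + w)
    simp only [map_add, add_apply, halt] at this
    linarith
  have h1 := hθ x (X x) Y Z hY hZ
  have h2 := hθ x (Y x) X Z hX hZ
  have h3 := hθ x (Z x) X Y hX hY
  rw [covForm] at h1 h2 h3
  rw [bracket_eq D ht hX hY, bracket_eq D ht hX hZ, bracket_eq D ht hY hZ]
  simp only [map_sub, sub_apply]
  have s1 := hskew (Y x) (D Z x (X x))
  have s2 := hskew (X x) (D Z x (Y x))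
  have s3 := hskew (X x) (D Y x (Z x))
  linarith

end Volume

/-! ### Local normal form of an immersion -/

section Immersion

variable {n k : ℕ} {M : Type*} [TopologicalSpace M]
  [ChartedSpace (EuclideanSpace ℝ (Fin (4 * n))) M] [IsManifold (𝓡 (4 * n)) ∞ M]
  {N : Type*} [TopologicalSpace N]
  [ChartedSpace (EuclideanSpace ℝ (Fin (4 * k))) N] [IsManifold (𝓡 (4 * k)) ∞ N]
  {i : N → M}

omit [IsManifold (𝓡 (4 * n)) ∞ M] [IsManifold (𝓡 (4 * k)) ∞ N] in
/-- Around every point an immersion is, in suitable charts, a linear map which has a linear left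
inverse. -/
lemma exists_charts (hi : Manifold.IsImmersion (𝓡 (4 * k)) (𝓡 (4 * n)) ∞ i) (x : N) :
    ∃ ψ ∈ IsManifold.maximalAtlas (𝓡 (4 * k)) ∞ N, ∃ φ ∈ IsManifold.maximalAtlas (𝓡 (4 * n)) ∞ M,
    ∃ (j : EuclideanSpace ℝ (Fin (4 * k)) →L[ℝ] EuclideanSpace ℝ (Fin (4 * n)))
      (p : EuclideanSpace ℝ (Fin (4 * n)) →L[ℝ] EuclideanSpace ℝ (Fin (4 * k))),
      (∀ u, p (j u) = u) ∧ x ∈ ψ.source ∧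
        ∀ y ∈ ψ.source, i y ∈ φ.source ∧ φ (i y) = j (ψ y) := by
  have h := hi.isImmersionAt x
  refine ⟨h.domChart, h.domChart_mem_maximalAtlas, h.codChart, h.codChart_mem_maximalAtlas,
    h.equiv.toContinuousLinearMap ∘L ContinuousLinearMap.inl ℝ _ _,
    ContinuousLinearMap.fst ℝ _ _ ∘L h.equiv.symm.toContinuousLinearMap, fun u ↦ by simp,
    h.mem_domChart_source, fun y hy ↦ ⟨h.source_subset_preimage_source hy, ?_⟩⟩
  have hm : h.domChart y ∈ (h.domChart.extend (𝓡 (4 * k))).target := by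
    simpa using h.domChart.map_source hy
  simpa [h.domChart.left_inv hy] using h.writtenInCharts hm

omit [IsManifold (𝓡 (4 * n)) ∞ M] [IsManifold (𝓡 (4 * k)) ∞ N] in
/-- An immersion has a smooth left inverse locally. -/
lemma exists_retraction (hi : Manifold.IsImmersion (𝓡 (4 * k)) (𝓡 (4 * n)) ∞ i) (x : N) :
    ∃ (r : M → N) (V : Set M), IsOpen V ∧ i x ∈ V ∧ ContMDiffOn (𝓡 (4 * n)) (𝓡 (4 * k)) ∞ r V ∧
      ∀ᶠ y in 𝓝 x, r (i y) = y := by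
  obtain ⟨ψ, hψ, φ, hφ, j, p, hp, hx, h⟩ := exists_charts hi x
  refine ⟨fun z ↦ ψ.symm (p (φ z)), φ.source ∩ (φ ⁻¹' (p ⁻¹' ψ.target)),
    φ.isOpen_inter_preimage (ψ.open_target.preimage p.continuous), ⟨(h x hx).1, ?_⟩, ?_, ?_⟩
  · rw [mem_preimage, mem_preimage, (h x hx).2, hp]
    exact ψ.map_source hx
  · refine (contMDiffOn_symm_of_mem_maximalAtlas hψ).comp (t := ψ.target) ?_ fun z hz ↦ hz.2
    exact p.contMDiff.comp_contMDiffOn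
      ((contMDiffOn_of_mem_maximalAtlas hφ).mono inter_subset_left)
  · filter_upwards [ψ.open_source.mem_nhds hx] with y hy
    rw [(h y hy).2, hp, ψ.left_inv hy]

omit [IsManifold (𝓡 (4 * k)) ∞ N] in
lemma isInvertible_mfderiv_chart {ψ : OpenPartialHomeomorph N (EuclideanSpace ℝ (Fin (4 * k)))}
    (hψ : ψ ∈ IsManifold.maximalAtlas (𝓡 (4 * k)) ∞ N) {y : N} (hy : y ∈ ψ.source) :
    (mfderiv (𝓡 (4 * k)) 𝓘(ℝ, EuclideanSpace ℝ (Fin (4 * k))) ψ y).IsInvertible := by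
  have : ψ.MDifferentiable (𝓡 (4 * k)) 𝓘(ℝ, EuclideanSpace ℝ (Fin (4 * k))) :=
    ⟨(contMDiffOn_of_mem_maximalAtlas hψ).mdifferentiableOn (by simp),
      (contMDiffOn_symm_of_mem_maximalAtlas hψ).mdifferentiableOn (by simp)⟩
  exact ⟨this.mfderiv hy, rfl⟩

/-- The constant vector field `u` on a Euclidean space. -/
def constField {m : ℕ} (u : EuclideanSpace ℝ (Fin m)) (y : EuclideanSpace ℝ (Fin m)) :
    TangentSpace 𝓘(ℝ, EuclideanSpace ℝ (Fin m)) y := u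

lemma constField_mdifferentiableAt {m : ℕ} (u v : EuclideanSpace ℝ (Fin m)) :
    MDifferentiableAt 𝓘(ℝ, EuclideanSpace ℝ (Fin m))
      (𝓘(ℝ, EuclideanSpace ℝ (Fin m)).prod 𝓘(ℝ, EuclideanSpace ℝ (Fin m)))
      (fun y ↦ Bundle.TotalSpace.mk' (EuclideanSpace ℝ (Fin m)) y (constField u y)) v :=
  (contMDiffAt_vectorSpace_iff_contDiffAt (n := 1) (V := constField u)
    |>.mpr contDiffAt_const).mdifferentiableAt one_ne_zero

lemma bracket_constField {m : ℕ} (u w y : EuclideanSpace ℝ (Fin m)) :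
    VectorField.mlieBracket 𝓘(ℝ, EuclideanSpace ℝ (Fin m)) (constField u) (constField w) y = 0 := by
  rw [← VectorField.mlieBracketWithin_univ, VectorField.mlieBracketWithin_eq_lieBracketWithin]
  change fderivWithin ℝ (fun _ ↦ w) univ y u - fderivWithin ℝ (fun _ ↦ u) univ y w = 0
  simp

/-- The vector field with constant coefficients `u` in the chart `ψ`. -/
def chartField (ψ : N → EuclideanSpace ℝ (Fin (4 * k)))
    (u : EuclideanSpace ℝ (Fin (4 * k))) : VField k N :=
  VectorField.mpullback (𝓡 (4 * k)) 𝓘(ℝ, EuclideanSpace ℝ (Fin (4 * k))) ψ (constField u)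

omit [IsManifold (𝓡 (4 * k)) ∞ N] in
lemma chartField_apply (ψ : N → EuclideanSpace ℝ (Fin (4 * k)))
    (u : EuclideanSpace ℝ (Fin (4 * k))) (y : N) : chartField ψ u y =
      (mfderiv (𝓡 (4 * k)) 𝓘(ℝ, EuclideanSpace ℝ (Fin (4 * k))) ψ y).inverse u := rfl

lemma chartField_diffAt {ψ : OpenPartialHomeomorph N (EuclideanSpace ℝ (Fin (4 * k)))}
    (hψ : ψ ∈ IsManifold.maximalAtlas (𝓡 (4 * k)) ∞ N) {y : N} (hy : y ∈ ψ.source)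
    (u : EuclideanSpace ℝ (Fin (4 * k))) : DiffAt k (chartField ψ u) y :=
  MDifferentiableAt.mpullback_vectorField (n := ∞) (constField_mdifferentiableAt u _)
    (contMDiffAt_of_mem_maximalAtlas hψ hy) (isInvertible_mfderiv_chart hψ hy) ENat.LEInfty.out

lemma bracket_chartField {ψ : OpenPartialHomeomorph N (EuclideanSpace ℝ (Fin (4 * k)))}
    (hψ : ψ ∈ IsManifold.maximalAtlas (𝓡 (4 * k)) ∞ N) {y : N} (hy : y ∈ ψ.source)
    (u w : EuclideanSpace ℝ (Fin (4 * k))) :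
    VectorField.mlieBracket (𝓡 (4 * k)) (chartField ψ u) (chartField ψ w) y = 0 := by
  have h2 : minSmoothness ℝ 2 ≤ ∞ := by
    rw [minSmoothness_of_isRCLikeNormedField]; exact ENat.LEInfty.out
  have : IsManifold (𝓡 (4 * k)) (minSmoothness ℝ 2) N := IsManifold.of_le h2
  rw [chartField, chartField, ← VectorField.mpullback_mlieBracket (n := ∞) (constField_mdifferentiableAt u _)
    (constField_mdifferentiableAt w _) (contMDiffAt_of_mem_maximalAtlas hψ hy) h2, VectorField.mpullback_apply, bracket_constField]
  exact map_zero _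

omit [IsManifold (𝓡 (4 * n)) ∞ M] [IsManifold (𝓡 (4 * k)) ∞ N] in
lemma push_chartField (hi : Manifold.IsImmersion (𝓡 (4 * k)) (𝓡 (4 * n)) ∞ i)
    {ψ : OpenPartialHomeomorph N (EuclideanSpace ℝ (Fin (4 * k)))}
    (hψ : ψ ∈ IsManifold.maximalAtlas (𝓡 (4 * k)) ∞ N)
    {φ : OpenPartialHomeomorph M (EuclideanSpace ℝ (Fin (4 * n)))}
    (hφ : φ ∈ IsManifold.maximalAtlas (𝓡 (4 * n)) ∞ M)
    {j : EuclideanSpace ℝ (Fin (4 * k)) →L[ℝ] EuclideanSpace ℝ (Fin (4 * n))}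
    (h : ∀ y ∈ ψ.source, i y ∈ φ.source ∧ φ (i y) = j (ψ y)) {y : N} (hy : y ∈ ψ.source)
    (u : EuclideanSpace ℝ (Fin (4 * k))) :
    push i y (chartField ψ u y) = chartField φ (j u) (i y) := by
  have hm := isInvertible_mfderiv_chart hφ (h y hy).1
  rw [chartField_apply, chartField_apply]
  refine (hm.inverse_apply_eq.mpr ?_).symm
  have e : mfderiv (𝓡 (4 * k)) (𝓡 (4 * n)) (φ ∘ i) y = mfderiv (𝓡 (4 * k)) (𝓡 (4 * n)) (j ∘ ψ) y :=
    Filter.EventuallyEq.mfderiv_eq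
      (Filter.mem_of_superset (ψ.open_source.mem_nhds hy) fun z hz ↦ (h z hz).2)
  have hj : HasMFDerivAt 𝓘(ℝ, EuclideanSpace ℝ (Fin (4 * k)))
    𝓘(ℝ, EuclideanSpace ℝ (Fin (4 * n))) j (ψ y) j := j.hasMFDerivAt
  rw [mfderiv_comp y ((contMDiffAt_of_mem_maximalAtlas hφ (h y hy).1).mdifferentiableAt (by simp))
    (hi.contMDiff.mdifferentiableAt (by simp)), mfderiv_comp y hj.mdifferentiableAt
    ((contMDiffAt_of_mem_maximalAtlas hψ hy).mdifferentiableAt (by simp)), hj.mfderiv] at e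
  have e' := DFunLike.congr_fun e ((mfderiv (𝓡 (4 * k)) 𝓘(ℝ, EuclideanSpace ℝ (Fin (4 * k)))
    ψ y).inverse u)
  refine Eq.trans ?_ e'.symm
  exact congrArg j ((isInvertible_mfderiv_chart hψ hy).self_apply_inverse _).symm

/-- Any two vectors tangent to `N` extend to commuting vector fields on `N` which are related to
commuting vector fields on `M`. -/
lemma exists_commuting_fields (hi : Manifold.IsImmersion (𝓡 (4 * k)) (𝓡 (4 * n)) ∞ i) (x : N) :
    ∃ (X' : TangentSpace (𝓡 (4 * k)) x → VField k N) (X : TangentSpace (𝓡 (4 * k)) x → VField n M),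
      ∀ u, X' u x = u ∧ DiffAt k (X' u) x ∧ DiffAt n (X u) (i x) ∧
        (∀ᶠ y in 𝓝 x, push i y (X' u y) = X u (i y)) ∧
        ∀ w, VectorField.mlieBracket (𝓡 (4 * k)) (X' u) (X' w) x = 0 ∧
          VectorField.mlieBracket (𝓡 (4 * n)) (X u) (X w) (i x) = 0 := by
  obtain ⟨ψ, hψ, φ, hφ, j, p, hp, hx, h⟩ := exists_charts hi x
  have hinv := isInvertible_mfderiv_chart hψ hx
  refine ⟨fun u ↦ chartField ψ (mfderiv (𝓡 (4 * k)) 𝓘(ℝ, EuclideanSpace ℝ (Fin (4 * k))) ψ x u),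
    fun u ↦ chartField φ (j (mfderiv (𝓡 (4 * k)) 𝓘(ℝ, EuclideanSpace ℝ (Fin (4 * k))) ψ x u)),
    fun u ↦ ⟨?_, chartField_diffAt hψ hx _, chartField_diffAt hφ (h x hx).1 _, ?_,
      fun w ↦ ⟨bracket_chartField hψ hx _ _, bracket_chartField hφ (h x hx).1 _ _⟩⟩⟩
  · exact hinv.inverse_apply_self u
  · filter_upwards [ψ.open_source.mem_nhds hx] with y hy
    exact push_chartField hi hψ hφ (fun y hy ↦ h y hy) hy _

end Immersion

/-! ### Smooth vector fields -/

section SmoothFields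

variable {n : ℕ} {M : Type*} [TopologicalSpace M]
  [ChartedSpace (EuclideanSpace ℝ (Fin (4 * n))) M] [IsManifold (𝓡 (4 * n)) ∞ M]

/-- The vector field `X` is smooth at `x`. -/
def SmoothAt (X : VField n M) (x : M) : Prop :=
  ContMDiffAt (𝓡 (4 * n)) ((𝓡 (4 * n)).prod 𝓘(ℝ, EuclideanSpace ℝ (Fin (4 * n)))) ∞
    (fun y ↦ Bundle.TotalSpace.mk' (EuclideanSpace ℝ (Fin (4 * n))) y (X y)) x

variable {x : M} {X Y : VField n M}

lemma SmoothAt.diffAt (h : SmoothAt X x) : DiffAt n X x :=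
  ContMDiffAt.mdifferentiableAt h (by simp)

lemma SmoothAt.congr (hX : SmoothAt X x) (h : ∀ᶠ y in 𝓝 x, Y y = X y) : SmoothAt Y x :=
  ContMDiffAt.congr_of_eventuallyEq hX (h.mono fun y hy ↦ by simp only [hy])

lemma SmoothAt.smul {f : M → ℝ} (hf : ContMDiffAt (𝓡 (4 * n)) 𝓘(ℝ, ℝ) ∞ f x)
    (hX : SmoothAt X x) : SmoothAt (f • X) x :=
  ContMDiffAt.smul_section hf hX

/-- A vector field which is smooth near a point agrees there with a global smooth one. -/
lemma exists_global_smooth [T2Space M] {V : Set M} (hV : IsOpen V) (hx : x ∈ V)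
    (hX : ∀ y ∈ V, SmoothAt X y) :
    ∃ Z : VField n M, (∀ y, SmoothAt Z y) ∧ ∀ᶠ y in 𝓝 x, Z y = X y := by
  obtain ⟨ρ, -, hρ⟩ := (SmoothBumpFunction.nhds_basis_tsupport (I := 𝓡 (4 * n)) x).mem_iff.mp
    (hV.mem_nhds hx)
  refine ⟨(ρ : M → ℝ) • X, fun y ↦ ?_, ?_⟩
  · by_cases hy : y ∈ tsupport ρ
    · exact (hX y (hρ hy)).smul ρ.contMDiffAt
    · have h0 : SmoothAt (0 : VField n M) y := Bundle.contMDiffAt_zeroSection ..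
      refine h0.congr ?_
      filter_upwards [(isClosed_tsupport ρ).isOpen_compl.mem_nhds hy] with z hz
      simp [image_eq_zero_of_notMem_tsupport hz]
  · filter_upwards [ρ.eventuallyEq_one] with y hy
    simp [hy]

section Hom

variable {F : Type*} [NormedAddCommGroup F] [NormedSpace ℝ F] {W : M → Type*}
  [TopologicalSpace (Bundle.TotalSpace F W)] [∀ x, AddCommGroup (W x)] [∀ x, Module ℝ (W x)]
  [∀ x, TopologicalSpace (W x)] [∀ x, IsTopologicalAddGroup (W x)]
  [∀ x, ContinuousSMul ℝ (W x)] [FiberBundle F W] [VectorBundle ℝ F W]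

/-- A field of linear maps on the tangent spaces is smooth if it maps smooth vector fields to
smooth sections. -/
lemma contMDiffAt_hom_of_apply {σ : Π y : M, TangentSpace (𝓡 (4 * n)) y →L[ℝ] W y}
    (h : ∀ Y : VField n M, SmoothAt Y x → ContMDiffAt (𝓡 (4 * n)) ((𝓡 (4 * n)).prod 𝓘(ℝ, F)) ∞
      (fun y ↦ Bundle.TotalSpace.mk' F y (σ y (Y y))) x) :
    ContMDiffAt (𝓡 (4 * n)) ((𝓡 (4 * n)).prod 𝓘(ℝ, EuclideanSpace ℝ (Fin (4 * n)) →L[ℝ] F)) ∞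
      (fun y ↦ Bundle.TotalSpace.mk' (EuclideanSpace ℝ (Fin (4 * n)) →L[ℝ] F)
        (E := fun y ↦ TangentSpace (𝓡 (4 * n)) y →L[ℝ] W y) y (σ y)) x := by
  rw [contMDiffAt_hom_bundle]
  refine ⟨contMDiffAt_id, ?_⟩
  set b := (EuclideanSpace.basisFun (Fin (4 * n)) ℝ).toBasis
  set e := trivializationAt (EuclideanSpace ℝ (Fin (4 * n)))
    (TangentSpace (𝓡 (4 * n)) : M → Type _) x
  have hx : x ∈ e.baseSet := FiberBundle.mem_baseSet_trivializationAt' x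
  have hx' : x ∈ (trivializationAt F W x).baseSet := FiberBundle.mem_baseSet_trivializationAt' x
  have hb (i) : SmoothAt (e.localFrame b i) x := contMDiffAt_localFrame_of_mem ∞ e b i hx
  have hs (i) := (Bundle.contMDiffAt_section x).mp (h _ (hb i))
  -- a linear map on a Euclidean space is the sum of its values on a basis times the coordinates
  have : ContMDiffAt (𝓡 (4 * n)) 𝓘(ℝ, EuclideanSpace ℝ (Fin (4 * n)) →L[ℝ] F) ∞
      (fun y ↦ ∑ i, ContinuousLinearMap.smulRightL ℝ (EuclideanSpace ℝ (Fin (4 * n))) F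
        (LinearMap.toContinuousLinearMap (b.coord i))
        (trivializationAt F W x ⟨y, σ y (e.localFrame b i y)⟩).2) x :=
    contMDiffAt_finsetSum fun i _ ↦ (ContinuousLinearMap.contMDiff _).contMDiffAt.comp x (hs i)
  refine this.congr_of_eventuallyEq ?_
  filter_upwards [e.open_baseSet.mem_nhds hx,
    (trivializationAt F W x).open_baseSet.mem_nhds hx'] with y hy hy'
  refine ContinuousLinearMap.coe_injective (b.ext fun j ↦ ?_)
  simp only [ContinuousLinearMap.coe_coe]
  rw [ContinuousLinearMap.inCoordinates_eq hy hy', sum_apply,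
    Finset.sum_eq_single j]
  · simp [e.localFrame_apply_of_mem_baseSet b hy, Bundle.Trivialization.basisAt]
    rfl
  · intro i _ hij
    simp [hij.symm]
  · simp

end Hom

end SmoothFields

/-! ### Restriction and extension of vector fields along an immersion -/

section Along

variable {n k : ℕ} {M : Type*} [TopologicalSpace M]
  [ChartedSpace (EuclideanSpace ℝ (Fin (4 * n))) M] [IsManifold (𝓡 (4 * n)) ∞ M]
  {N : Type*} [TopologicalSpace N]
  [ChartedSpace (EuclideanSpace ℝ (Fin (4 * k))) N] [IsManifold (𝓡 (4 * k)) ∞ N]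
  {i : N → M} {x : N} {r : M → N}

lemma contMDiffAt_mfderiv_apply (hi : ContMDiffAt (𝓡 (4 * k)) (𝓡 (4 * n)) ∞ i x)
    {Y : VField k N} (hY : SmoothAt Y x) :
    ContMDiffAt (𝓡 (4 * k)) ((𝓡 (4 * n)).prod 𝓘(ℝ, EuclideanSpace ℝ (Fin (4 * n)))) ∞
      (fun y ↦ Bundle.TotalSpace.mk' (EuclideanSpace ℝ (Fin (4 * n))) (i y)
        (push (n := n) (k := k) i y (Y y))) x :=
  ContMDiffAt.clm_apply_of_inCoordinates (b₁ := id) (hi.mfderiv_const (by simp)) hY hi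

lemma mdifferentiableAt_mfderiv_apply (hi : ContMDiffAt (𝓡 (4 * k)) (𝓡 (4 * n)) ∞ i x)
    {Y : VField k N} (hY : DiffAt k Y x) :
    MDifferentiableAt (𝓡 (4 * k)) ((𝓡 (4 * n)).prod 𝓘(ℝ, EuclideanSpace ℝ (Fin (4 * n))))
      (fun y ↦ Bundle.TotalSpace.mk' (EuclideanSpace ℝ (Fin (4 * n))) (i y)
        (push (n := n) (k := k) i y (Y y))) x :=
  MDifferentiableAt.clm_apply_of_inCoordinates (b₁ := id)
    ((hi.mfderiv_const (m := ∞) (by simp)).mdifferentiableAt (by simp)) hY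
    (hi.mdifferentiableAt (by simp))

/-- The differential at `i y` of a left inverse `r` of `i`, as a map to `T_y N`. This is meaningful
only if `r (i y) = y`; then it is a left inverse of the differential of `i` at `y`. -/
def pull (i : N → M) (r : M → N) (y : N) :
    TangentSpace (𝓡 (4 * n)) (i y) →L[ℝ] TangentSpace (𝓡 (4 * k)) y :=
  (mfderiv (𝓡 (4 * n)) (𝓡 (4 * k)) r (i y) :
    EuclideanSpace ℝ (Fin (4 * n)) →L[ℝ] EuclideanSpace ℝ (Fin (4 * k)))

omit [IsManifold (𝓡 (4 * n)) ∞ M] [IsManifold (𝓡 (4 * k)) ∞ N] in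
lemma pull_push (hi : ContMDiffAt (𝓡 (4 * k)) (𝓡 (4 * n)) ∞ i x)
    (hr : ContMDiffAt (𝓡 (4 * n)) (𝓡 (4 * k)) ∞ r (i x)) (h : ∀ᶠ y in 𝓝 x, r (i y) = y)
    (u : TangentSpace (𝓡 (4 * k)) x) : pull (n := n) i r x (push i x u) = u := by
  have e : mfderiv (𝓡 (4 * k)) (𝓡 (4 * k)) (r ∘ i) x = mfderiv (𝓡 (4 * k)) (𝓡 (4 * k)) id x :=
    Filter.EventuallyEq.mfderiv_eq h
  rw [mfderiv_comp x (hr.mdifferentiableAt (by simp)) (hi.mdifferentiableAt (by simp)),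
    mfderiv_id] at e
  exact DFunLike.congr_fun e u

lemma pull_smoothAt (hi : ContMDiffAt (𝓡 (4 * k)) (𝓡 (4 * n)) ∞ i x)
    (hr : ContMDiffAt (𝓡 (4 * n)) (𝓡 (4 * k)) ∞ r (i x)) (h : ∀ᶠ y in 𝓝 x, r (i y) = y)
    {Z : VField n M} (hZ : SmoothAt Z (i x)) : SmoothAt (fun y ↦ pull (k := k) i r y (Z (i y))) x := by
  refine ((contMDiffAt_mfderiv_apply hr hZ).comp x hi).congr_of_eventuallyEq ?_
  filter_upwards [h] with y hy
  exact Bundle.TotalSpace.ext hy.symm HEq.rfl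

lemma pull_diffAt (hi : ContMDiffAt (𝓡 (4 * k)) (𝓡 (4 * n)) ∞ i x)
    (hr : ContMDiffAt (𝓡 (4 * n)) (𝓡 (4 * k)) ∞ r (i x)) (h : ∀ᶠ y in 𝓝 x, r (i y) = y)
    {Z : VField n M} (hZ : DiffAt n Z (i x)) : DiffAt k (fun y ↦ pull (k := k) i r y (Z (i y))) x := by
  refine ((mdifferentiableAt_mfderiv_apply hr hZ).comp x
    (hi.mdifferentiableAt (by simp))).congr_of_eventuallyEq ?_
  filter_upwards [h] with y hy
  exact Bundle.TotalSpace.ext hy.symm HEq.rfl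

/-- The vector field near `i x` with the value `i_* Y'(r z)` at `z`, where vectors at `i (r z)`
are carried to `z` by means of a trivialization of the tangent bundle of `M`. -/
def extendAlong (i : N → M) (r : M → N) (x : N) (Y : VField k N) : VField n M := fun z ↦
  (trivializationAt (EuclideanSpace ℝ (Fin (4 * n))) (TangentSpace (𝓡 (4 * n)) : M → Type _)
    (i x)).symm z ((trivializationAt (EuclideanSpace ℝ (Fin (4 * n)))
      (TangentSpace (𝓡 (4 * n)) : M → Type _) (i x)) ⟨i (r z), push i (r z) (Y (r z))⟩).2

omit [IsManifold (𝓡 (4 * k)) ∞ N] in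
lemma extendAlong_eq (hi : ContinuousAt i x) (h : ∀ᶠ y in 𝓝 x, r (i y) = y) (Y : VField k N) :
    ∀ᶠ y in 𝓝 x, push i y (Y y) = (extendAlong i r x Y : VField n M) (i y) := by
  set e := trivializationAt (EuclideanSpace ℝ (Fin (4 * n)))
    (TangentSpace (𝓡 (4 * n)) : M → Type _) (i x) with he
  filter_upwards [h, hi (e.open_baseSet.mem_nhds (FiberBundle.mem_baseSet_trivializationAt' (i x)))]
    with y hy hb
  rw [extendAlong, hy]
  exact (e.symm_apply_apply_mk hb _).symm

/-- The domain on which `extendAlong i r x Y` inherits the regularity of `Y`. -/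
def extendDomain (i : N → M) (r : M → N) (x : N) : Set M :=
  (chartAt (EuclideanSpace ℝ (Fin (4 * n))) (i x)).source ∩
    {z | i (r z) ∈ (chartAt (EuclideanSpace ℝ (Fin (4 * n))) (i x)).source}

lemma extendAlong_smoothAt {z : M} (hz : z ∈ (extendDomain (n := n) i r x))
    (hi : ContMDiffAt (𝓡 (4 * k)) (𝓡 (4 * n)) ∞ i (r z))
    (hr : ContMDiffAt (𝓡 (4 * n)) (𝓡 (4 * k)) ∞ r z)
    {Y : VField k N} (hY : SmoothAt Y (r z)) :
    SmoothAt (extendAlong i r x Y : VField n M) z := by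
  set e := trivializationAt (EuclideanSpace ℝ (Fin (4 * n)))
    (TangentSpace (𝓡 (4 * n)) : M → Type _) (i x) with he
  have hz2 : i (r z) ∈ e.baseSet := hz.2
  rw [SmoothAt, e.contMDiffAt_section_iff hz.1]
  have h1 := ((e.contMDiffAt_iff (e.mem_source.mpr (by exact hz2))).mp (contMDiffAt_mfderiv_apply hi hY)).2
  refine (h1.comp z hr).congr_of_eventuallyEq ?_
  filter_upwards [e.open_baseSet.mem_nhds hz.1] with y hy
  rw [extendAlong, e.apply_mk_symm hy]
  rfl

lemma extendAlong_diffAt {z : M} (hz : z ∈ (extendDomain (n := n) i r x))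
    (hi : ContMDiffAt (𝓡 (4 * k)) (𝓡 (4 * n)) ∞ i (r z))
    (hr : ContMDiffAt (𝓡 (4 * n)) (𝓡 (4 * k)) ∞ r z)
    {Y : VField k N} (hY : DiffAt k Y (r z)) :
    DiffAt n (extendAlong i r x Y : VField n M) z := by
  set e := trivializationAt (EuclideanSpace ℝ (Fin (4 * n)))
    (TangentSpace (𝓡 (4 * n)) : M → Type _) (i x) with he
  have hz2 : i (r z) ∈ e.baseSet := hz.2
  rw [DiffAt, e.mdifferentiableAt_section_iff _ _ hz.1]
  have h1 := ((e.mdifferentiableAt_totalSpace_iff _ _ (e.mem_source.mpr (by exact hz2))).mp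
    (mdifferentiableAt_mfderiv_apply hi hY)).2
  refine (h1.comp z (hr.mdifferentiableAt (by simp))).congr_of_eventuallyEq ?_
  filter_upwards [e.open_baseSet.mem_nhds hz.1] with y hy
  rw [extendAlong, e.apply_mk_symm hy]
  rfl

end Along

/-! ### Differentiation of extended vector fields -/

section Extends

variable {n k : ℕ} {M : Type*} [TopologicalSpace M]
  [ChartedSpace (EuclideanSpace ℝ (Fin (4 * n))) M] [IsManifold (𝓡 (4 * n)) ∞ M]
  {N : Type*} [TopologicalSpace N]
  [ChartedSpace (EuclideanSpace ℝ (Fin (4 * k))) N] [IsManifold (𝓡 (4 * k)) ∞ N]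
  {i : N → M} {x : N}

/-- The vector field `Y` on `M` extends the vector field `Y'` on `N` near `x`, and both are
differentiable. -/
structure Extends (i : N → M) (x : N) (Y' : VField k N) (Y : VField n M) : Prop where
  diffAt' : DiffAt k Y' x
  diffAt : DiffAt n Y (i x)
  eq : ∀ᶠ y in 𝓝 x, push i y (Y' y) = Y (i y)

lemma exists_extends (hi : Manifold.IsImmersion (𝓡 (4 * k)) (𝓡 (4 * n)) ∞ i) {Y' : VField k N}
    (hY : DiffAt k Y' x) : ∃ Y : VField n M, Extends i x Y' Y := by
  obtain ⟨r, V, hV, hx, hr, h⟩ := exists_retraction hi x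
  have hrx : r (i x) = x := h.self_of_nhds
  refine ⟨extendAlong i r x Y', hY, extendAlong_diffAt ⟨mem_chart_source _ _, ?_⟩
    (hi.contMDiff _) (hr.contMDiffAt (hV.mem_nhds hx)) (by rwa [hrx]),
    extendAlong_eq hi.contMDiff.continuous.continuousAt h Y'⟩
  rw [Set.mem_ofPred, hrx]
  exact mem_chart_source _ _

/-- Smooth vector fields on `N` have smooth extensions. -/
lemma exists_smooth_extension [T2Space M]
    (hi : Manifold.IsImmersion (𝓡 (4 * k)) (𝓡 (4 * n)) ∞ i) {Y' : VField k N}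
    (hY : ∀ y, SmoothAt Y' y) :
    ∃ Y : VField n M, (∀ z, SmoothAt Y z) ∧ ∀ᶠ y in 𝓝 x, push i y (Y' y) = Y (i y) := by
  obtain ⟨r, V, hV, hx, hr, h⟩ := exists_retraction hi x
  have hrx : r (i x) = x := h.self_of_nhds
  have hic := hi.contMDiff.continuous
  set B := (chartAt (EuclideanSpace ℝ (Fin (4 * n))) (i x)).source with hB
  have hBo : IsOpen B := (chartAt (EuclideanSpace ℝ (Fin (4 * n))) (i x)).open_source
  have ho : IsOpen (V ∩ (fun z ↦ i (r z)) ⁻¹' B) :=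
    (hic.comp_continuousOn hr.continuousOn).isOpen_inter_preimage hV hBo
  obtain ⟨Z, hZ, e⟩ := exists_global_smooth (X := extendAlong i r x Y')
    (ho.inter hBo) (x := i x) ⟨⟨hx, by rw [mem_preimage, hrx]; exact mem_chart_source _ _⟩,
      mem_chart_source _ _⟩ fun z hz ↦ extendAlong_smoothAt ⟨hz.2, hz.1.2⟩ (hi.contMDiff _)
        (hr.contMDiffAt (hV.mem_nhds hz.1.1)) (hY _)
  refine ⟨Z, hZ, ?_⟩
  filter_upwards [extendAlong_eq (n := n) hic.continuousAt h Y', hic.continuousAt.eventually e] with y h1 h2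
  rw [h1, h2]

omit [IsManifold (𝓡 (4 * k)) ∞ N] in
/-- A vector field which vanishes along the submanifold has zero derivative in tangential
directions. -/
lemma conn_eq_zero_of_eq_zero (D : Conn n M) (hi : MDifferentiableAt (𝓡 (4 * k)) (𝓡 (4 * n)) i x)
    {Z : VField n M} (hZ : DiffAt n Z (i x)) (h : ∀ᶠ y in 𝓝 x, Z (i y) = 0)
    (v : TangentSpace (𝓡 (4 * k)) x) : D Z (i x) (push i x v) = 0 := by
  set b := (EuclideanSpace.basisFun (Fin (4 * n)) ℝ).toBasis
  set e := trivializationAt (EuclideanSpace ℝ (Fin (4 * n)))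
    (TangentSpace (𝓡 (4 * n)) : M → Type _) (i x)
  have hx : i x ∈ e.baseSet := FiberBundle.mem_baseSet_trivializationAt' (i x)
  set c : Fin (4 * n) → M → ℝ := fun j z ↦ e.localFrameCoeff (𝓡 (4 * n)) b j z (Z z) with hc
  have hcd (j) : MDifferentiableAt (𝓡 (4 * n)) 𝓘(ℝ, ℝ) (c j) (i x) :=
    mdifferentiableAt_localFrameCoeff b hx hZ j
  have hs (j) : DiffAt n (e.localFrame b j) (i x) :=
    (contMDiffAt_localFrame_of_mem 1 e b j hx).mdifferentiableAt one_ne_zero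
  have hsum := conn_sum D Finset.univ (fun j ↦ c j • e.localFrame b j)
    fun j _ ↦ DiffAt.smul (hcd j) (hs j)
  have hc0 : ∀ᶠ y in 𝓝 x, ∀ j, c j (i y) = 0 := h.mono fun y hy j ↦ by simp [hc, hy]
  have hdc (j) : mvfderiv (𝓡 (4 * n)) (c j) (i x) (push i x v) = 0 := by
    rw [← mvfderiv_comp_apply x (hcd j) hi]
    have : mvfderiv (𝓡 (4 * k)) (c j ∘ i) x = mvfderiv (𝓡 (4 * k)) (fun _ ↦ (0 : ℝ)) x :=
      Filter.EventuallyEq.mfderiv_eq (hc0.mono fun y hy ↦ hy j)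
    rw [this, mvfderiv_const]
    rfl
  rw [conn_congr D hZ hsum.1 (e.eventually_eq_localFrame_sum_coeff_smul b hx), hsum.2, sum_apply]
  refine Finset.sum_eq_zero fun j _ ↦ ?_
  rw [conn_smul D (hcd j) (hs j), hdc, hc0.self_of_nhds j, zero_smul, zero_smul, add_zero]

variable {Y' Z' : VField k N} {Y Z : VField n M}

lemma Extends.conn_eq (D : Conn n M) (hi : MDifferentiableAt (𝓡 (4 * k)) (𝓡 (4 * n)) i x)
    (hY : Extends i x Y' Y) (hZ : Extends i x Y' Z) (v : TangentSpace (𝓡 (4 * k)) x) :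
    D Y (i x) (push i x v) = D Z (i x) (push i x v) := by
  rw [← sub_eq_zero, ← sub_apply, ← conn_sub D hY.diffAt hZ.diffAt]
  refine conn_eq_zero_of_eq_zero D hi (hY.diffAt.sub hZ.diffAt) ?_ v
  filter_upwards [hY.eq, hZ.eq] with y h1 h2
  rw [Pi.sub_apply, ← h1, ← h2, sub_self]

lemma Extends.apply (hY : Extends i x Y' Y) : Y (i x) = push i x (Y' x) := hY.eq.self_of_nhds.symm

lemma Extends.add (hY : Extends i x Y' Y) (hZ : Extends i x Z' Z) :
    Extends i x (Y' + Z') (Y + Z) where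
  diffAt' := hY.diffAt'.add hZ.diffAt'
  diffAt := hY.diffAt.add hZ.diffAt
  eq := by
    filter_upwards [hY.eq, hZ.eq] with y h1 h2
    rw [Pi.add_apply, Pi.add_apply, map_add, h1, h2]

/-- Derivatives of extensions satisfy the Leibniz rule. -/
lemma Extends.conn_smul (D : Conn n M) (hi : Manifold.IsImmersion (𝓡 (4 * k)) (𝓡 (4 * n)) ∞ i)
    {f : N → ℝ} (hf : MDifferentiableAt (𝓡 (4 * k)) 𝓘(ℝ, ℝ) f x) (hY : Extends i x Y' Y) :
    ∃ Z : VField n M, Extends i x (f • Y') Z ∧ ∀ v, D Z (i x) (push i x v) =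
      f x • D Y (i x) (push i x v) + mvfderiv (𝓡 (4 * k)) f x v • push i x (Y' x) := by
  obtain ⟨r, V, hV, hx, hr, h⟩ := exists_retraction hi x
  have hrx : r (i x) = x := h.self_of_nhds
  have hrd : MDifferentiableAt (𝓡 (4 * n)) (𝓡 (4 * k)) r (i x) :=
    (hr.contMDiffAt (hV.mem_nhds hx)).mdifferentiableAt (by simp)
  have hfr : MDifferentiableAt (𝓡 (4 * n)) 𝓘(ℝ, ℝ) (f ∘ r) (i x) :=
    MDifferentiableAt.comp (i x) (by rwa [hrx]) hrd
  refine ⟨(f ∘ r) • Y, ⟨DiffAt.smul hf hY.diffAt', hY.diffAt.smul hfr, ?_⟩, fun v ↦ ?_⟩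
  · filter_upwards [hY.eq, h] with y h1 h2
    rw [Pi.smul_apply', Pi.smul_apply', map_smul, h1, Function.comp_apply, h2]
  · have e : mvfderiv (𝓡 (4 * k)) ((f ∘ r) ∘ i) x = mvfderiv (𝓡 (4 * k)) f x :=
      Filter.EventuallyEq.mfderiv_eq (h.mono fun y hy ↦ congrArg f hy)
    rw [QSH.conn_smul D hfr hY.diffAt, ← mvfderiv_comp_apply x hfr
      (hi.contMDiff.mdifferentiableAt (by simp)), e, Function.comp_apply, hrx, hY.apply]

end Extends

/-! ### Almost quaternionic submanifolds are totally geodesic -/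

section TotallyGeodesic

variable {n k : ℕ} {M : Type*} [TopologicalSpace M]
  [ChartedSpace (EuclideanSpace ℝ (Fin (4 * n))) M] [IsManifold (𝓡 (4 * n)) ∞ M]
  {N : Type*} [TopologicalSpace N]
  [ChartedSpace (EuclideanSpace ℝ (Fin (4 * k))) N] [IsManifold (𝓡 (4 * k)) ∞ N]
  {i : N → M} {x : N} {Y' Z' : VField k N} {Y Z : VField n M} {D : Conn n M}
  {Q : EndSubspaceField n M}

omit [IsManifold (𝓡 (4 * n)) ∞ M] [IsManifold (𝓡 (4 * k)) ∞ N] in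
lemma push_injective (hi : Manifold.IsImmersion (𝓡 (4 * k)) (𝓡 (4 * n)) ∞ i) (x : N) :
    Function.Injective (push i x : TangentSpace (𝓡 (4 * k)) x →L[ℝ]
      TangentSpace (𝓡 (4 * n)) (i x)) := by
  obtain ⟨r, V, hV, hx, hr, h⟩ := exists_retraction hi x
  exact Function.LeftInverse.injective
    (pull_push (hi.contMDiff x) (hr.contMDiffAt (hV.mem_nhds hx)) h)

/-- A vector field on `M` which is tangent to `N` along `N` restricts to `N`. -/
lemma exists_extends_of_tangent (hi : Manifold.IsImmersion (𝓡 (4 * k)) (𝓡 (4 * n)) ∞ i)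
    (hZ : DiffAt n Z (i x)) (h : ∀ᶠ y in 𝓝 x, ∃ w : TangentSpace (𝓡 (4 * k)) y, Z (i y) = push i y w) :
    ∃ Z' : VField k N, Extends i x Z' Z := by
  obtain ⟨r, V, hV, hx, hr, hri⟩ := exists_retraction hi x
  refine ⟨_, pull_diffAt (hi.contMDiff x) (hr.contMDiffAt (hV.mem_nhds hx)) hri hZ, hZ, ?_⟩
  filter_upwards [h, hri.eventually_nhds,
    hi.contMDiff.continuous.continuousAt (hV.mem_nhds hx)] with y ⟨w, hw⟩ h1 h2
  rw [hw, pull_push (hi.contMDiff y) (hr.contMDiffAt (hV.mem_nhds h2)) h1]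

/-- The second fundamental form vanishes, because it is symmetric and complex linear with respect to
`J₁` and `J₂`. -/
lemma Extends.exists_conn_eq (hN : IsAlmostQuaternionicSubmanifold (k := k) Q i)
    (hQ : IsAlmostQuaternionic n Q) (hDQ : PreservesQ n D Q) (hD : D.torsion = 0)
    (hY : Extends i x Y' Y) (v : TangentSpace (𝓡 (4 * k)) x) :
    ∃ w : TangentSpace (𝓡 (4 * k)) x, D Y (i x) (push i x v) = push i x w := by
  classical
  obtain ⟨hi, hinv⟩ := hN
  have hid : MDifferentiableAt (𝓡 (4 * k)) (𝓡 (4 * n)) i x :=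
    hi.contMDiff.mdifferentiableAt (by simp)
  obtain ⟨U, J, hxU, hJ⟩ := hQ (i x)
  set S : Submodule ℝ (TangentSpace (𝓡 (4 * n)) (i x)) :=
    LinearMap.range (push i x : TangentSpace (𝓡 (4 * k)) x →L[ℝ] _).toLinearMap with hS
  have hSJ {q} (hq : q ∈ Q (i x)) : S ≤ S.comap q.toLinearMap := by
    rintro _ ⟨u, rfl⟩
    obtain ⟨w, hw⟩ := hinv x q hq u
    exact ⟨w, hw.symm⟩
  -- `Φ u Y'` is the class of the derivative in direction `u` of any extension of `Y'`.
  let E : VField k N → VField n M := fun Y' ↦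
    if h : DiffAt k Y' x then (exists_extends hi h).choose else 0
  have hE {Y'} (h : DiffAt k Y' x) : Extends i x Y' (E Y') := by
    simp only [E, dif_pos h]
    exact (exists_extends hi h).choose_spec
  let Φ : TangentSpace (𝓡 (4 * k)) x → VField k N → TangentSpace (𝓡 (4 * n)) (i x) ⧸ S :=
    fun u Y' ↦ S.mkQ (D (E Y') (i x) (push i x u))
  have hΦ (u) {Y' Y} (h : Extends i x Y' Y) : Φ u Y' = S.mkQ (D Y (i x) (push i x u)) :=
    congrArg S.mkQ ((hE h.diffAt').conn_eq D hid h u)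
  have hT (u) : TensorialAt (𝓡 (4 * k)) (EuclideanSpace ℝ (Fin (4 * k))) (Φ u) x := by
    refine ⟨fun {f σ} hf hσ ↦ ?_, fun {σ τ} hσ hτ ↦ ?_⟩
    · obtain ⟨Z, hZ, e⟩ := (hE hσ).conn_smul D hi hf
      have h0 : S.mkQ (push i x (σ x)) = 0 := by
        rw [Submodule.mkQ_apply, Submodule.Quotient.mk_eq_zero]; exact ⟨_, rfl⟩
      rw [hΦ u hZ, e, hΦ u (hE hσ), map_add, map_smul, map_smul, h0, smul_zero, add_zero]
    · rw [hΦ u ((hE hσ).add (hE hτ)), conn_add D (hE hσ).diffAt (hE hτ).diffAt, add_apply, map_add]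
  obtain ⟨X', X, hX⟩ := exists_commuting_fields hi x
  have hXe (u) : Extends i x (X' u) (X u) := ⟨(hX u).2.1, (hX u).2.2.1, (hX u).2.2.2.1⟩
  have hXx (u) : X u (i x) = push i x u := by rw [(hXe u).apply, (hX u).1]
  have hpt (u) {Z'} (hZ : DiffAt k Z' x) : Φ u Z' = S.mkQ (D (X (Z' x)) (i x) (push i x u)) := by
    rw [← hΦ u (hXe _)]
    exact (hT u).pointwise hZ (hXe _).diffAt' (hX _).1.symm
  have hcomm (a : Fin 3) (u w w' : TangentSpace (𝓡 (4 * k)) x)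
      (hw : J a (i x) (push i x w) = push i x w') :
      S.mkQ (D (X w') (i x) (push i x u)) =
        S.mapQ S (J a (i x)).toLinearMap (hSJ (hJ.mem hxU a))
          (S.mkQ (D (X w) (i x) (push i x u))) := by
    obtain ⟨q, hq, hm⟩ := hDQ.exists_hasCovDeriv hJ.isOpen (hJ.smooth a)
      (fun y hy ↦ hJ.mem hy a) hxU
    obtain ⟨hd, e⟩ := hq _ (hXe w).diffAt
    obtain ⟨Z', hZ'⟩ := exists_extends_of_tangent hi hd (by
      filter_upwards [(hXe w).eq,
        hi.contMDiff.continuous.continuousAt (hJ.isOpen.mem_nhds hxU)] with y h1 h2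
      obtain ⟨w, hw⟩ := hinv y _ (hJ.mem h2 a) (X' w y)
      exact ⟨w, by rw [← h1, hw]⟩)
    have hZx : Z' x = w' := push_injective hi x (by rw [← hZ'.apply, hXx, hw])
    obtain ⟨p, hp, hqp⟩ := hm (push i x u)
    have h0 : S.mkQ (q (push i x u) (push i x w)) = 0 := by
      rw [hqp, Submodule.mkQ_apply, Submodule.Quotient.mk_eq_zero]
      exact hSJ hp ⟨_, rfl⟩
    have := hpt u hZ'.diffAt'
    rw [hΦ u hZ', hZx, e, hXx, map_add, h0, add_zero] at this
    exact this.symm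
  choose I hI using fun a w ↦ hinv x _ (hJ.mem hxU a) w
  have key := ((hJ.triple hxU).mapQ (hSJ (hJ.mem hxU 0)) (hSJ (hJ.mem hxU 1))
    (hSJ (hJ.mem hxU 2))).eq_zero_of_symm_of_comm (I' := I 0) (J' := I 1)
    (fun u w ↦ S.mkQ (D (X w) (i x) (push i x u)))
    (fun u w ↦ by
      have := bracket_eq D hD (hXe u).diffAt (hXe w).diffAt
      rw [((hX u).2.2.2.2 w).2, hXx, hXx] at this
      exact congrArg S.mkQ (sub_eq_zero.mp this.symm))
    (fun u w ↦ hcomm 0 u w _ (hI 0 w)) (fun u w ↦ hcomm 1 u w _ (hI 1 w)) v (Y' x)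
  have h1 := hpt v hY.diffAt'
  rw [hΦ v hY, key, Submodule.mkQ_apply, Submodule.Quotient.mk_eq_zero] at h1
  obtain ⟨w, hw⟩ := h1
  exact ⟨w, hw.symm⟩

end TotallyGeodesic

/-! ### The induced connection -/

section Induced

variable {n k : ℕ} {M : Type*} [TopologicalSpace M]
  [ChartedSpace (EuclideanSpace ℝ (Fin (4 * n))) M] [IsManifold (𝓡 (4 * n)) ∞ M]
  {N : Type*} [TopologicalSpace N]
  [ChartedSpace (EuclideanSpace ℝ (Fin (4 * k))) N] [IsManifold (𝓡 (4 * k)) ∞ N]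
  {i : N → M} {x : N} {Y' Z' : VField k N} {Y Z : VField n M} {D : Conn n M} {D' : Conn k N}
  {Q : EndSubspaceField n M} {θ : FormField n M}

omit [IsManifold (𝓡 (4 * n)) ∞ M] [IsManifold (𝓡 (4 * k)) ∞ N] in
lemma exists_push_leftInverse (hi : Manifold.IsImmersion (𝓡 (4 * k)) (𝓡 (4 * n)) ∞ i) (x : N) :
    ∃ L : TangentSpace (𝓡 (4 * n)) (i x) →L[ℝ] TangentSpace (𝓡 (4 * k)) x,
      ∀ u, L (push i x u) = u := by
  obtain ⟨r, V, hV, hx, hr, h⟩ := exists_retraction hi x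
  exact ⟨pull i r x, pull_push (hi.contMDiff x) (hr.contMDiffAt (hV.mem_nhds hx)) h⟩

/-- If `N` is totally geodesic for the connection `D`, then `D` restricts to a connection
on `N`. -/
lemma exists_isRestriction (hi : Manifold.IsImmersion (𝓡 (4 * k)) (𝓡 (4 * n)) ∞ i)
    (H : ∀ (x : N) (Y' : VField k N) (Y : VField n M), Extends i x Y' Y →
      ∀ v : TangentSpace (𝓡 (4 * k)) x, ∃ w : TangentSpace (𝓡 (4 * k)) x,
        D Y (i x) (push i x v) = push i x w) :
    ∃ D' : Conn k N, IsRestriction i D D' := by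
  classical
  have hid (x) : MDifferentiableAt (𝓡 (4 * k)) (𝓡 (4 * n)) i x :=
    hi.contMDiff.mdifferentiableAt (by simp)
  choose L hL using exists_push_leftInverse hi
  let cov : VField k N → Π x : N, TangentSpace (𝓡 (4 * k)) x →L[ℝ] TangentSpace (𝓡 (4 * k)) x :=
    fun Y' x ↦ if h : DiffAt k Y' x then
      (L x).comp ((D (exists_extends hi h).choose (i x)).comp (push i x)) else 0
  have hcov {x Y' Y} (h : Extends i x Y' Y) (v) :
      push i x (cov Y' x v) = D Y (i x) (push i x v) := by
    have hE := (exists_extends hi h.diffAt').choose_spec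
    obtain ⟨w, hw⟩ := H x _ _ hE v
    have e : cov Y' x v = L x (D (exists_extends hi h.diffAt').choose (i x) (push i x v)) := by
      simp only [cov, dif_pos h.diffAt']
      rfl
    rw [e, h.conn_eq D (hid x) hE, hw, hL]
  refine ⟨⟨cov, ⟨fun {σ τ x} hσ hτ _ ↦ ?_, fun {σ g x} hσ hg _ ↦ ?_⟩⟩,
    fun x Y' Y h1 h2 h3 v ↦ hcov ⟨h1, h2, h3⟩ v⟩
  · obtain ⟨Y, hY⟩ := exists_extends hi hσ
    obtain ⟨Z, hZ⟩ := exists_extends hi hτ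
    ext1 v
    apply push_injective hi x
    rw [hcov (hY.add hZ), conn_add D hY.diffAt hZ.diffAt, add_apply, add_apply, map_add, hcov hY,
      hcov hZ]
  · obtain ⟨Y, hY⟩ := exists_extends hi hσ
    obtain ⟨Z, hZ, e⟩ := hY.conn_smul D hi hg
    ext1 v
    apply push_injective hi x
    change _ = push i x (g x • cov σ x v + mvfderiv (𝓡 (4 * k)) g x v • σ x)
    rw [hcov hZ, e, ← hcov hY, map_add, map_smul, map_smul]

lemma IsRestriction.apply (h : IsRestriction i D D') (hY : Extends i x Y' Y)
    (v : TangentSpace (𝓡 (4 * k)) x) : push i x (D' Y' x v) = D Y (i x) (push i x v) :=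
  h x Y' Y hY.diffAt' hY.diffAt hY.eq v

lemma IsRestriction.torsion_eq_zero (h : IsRestriction i D D')
    (hi : Manifold.IsImmersion (𝓡 (4 * k)) (𝓡 (4 * n)) ∞ i) (hD : D.torsion = 0) :
    D'.torsion = 0 := by
  ext1 x
  ext1 u
  ext1 w
  obtain ⟨X', X, hX⟩ := exists_commuting_fields hi x
  have hXe (u) : Extends i x (X' u) (X u) := ⟨(hX u).2.1, (hX u).2.2.1, (hX u).2.2.2.1⟩
  have e := D'.torsion_apply (hX u).2.1 (hX w).2.1
  have e' := bracket_eq D hD (hXe u).diffAt (hXe w).diffAt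
  rw [(hX u).1, (hX w).1, ((hX u).2.2.2.2 w).1, sub_zero] at e
  rw [((hX u).2.2.2.2 w).2, (hXe u).apply, (hXe w).apply, (hX u).1, (hX w).1, ← h.apply (hXe w),
    ← h.apply (hXe u), ← map_sub] at e'
  rw [e]
  exact push_injective hi x (by rw [← e']; exact (map_zero _).symm)

lemma IsRestriction.preservesForm (h : IsRestriction i D D')
    (hi : Manifold.IsImmersion (𝓡 (4 * k)) (𝓡 (4 * n)) ∞ i) (hs : SmoothForm n θ)
    (hθ : PreservesForm n D θ) : PreservesForm k D' (pullForm θ i) := by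
  intro x v Y' Z' hY hZ
  obtain ⟨Y, hY⟩ := exists_extends hi hY
  obtain ⟨Z, hZ⟩ := exists_extends hi hZ
  have e := hθ (i x) (push i x v) Y Z hY.diffAt hZ.diffAt
  have e' : mvfderiv (𝓡 (4 * k)) (fun y ↦ pullForm θ i y (Y' y) (Z' y)) x
      = mvfderiv (𝓡 (4 * k)) ((fun z ↦ θ z (Y z) (Z z)) ∘ i) x := by
    refine Filter.EventuallyEq.mfderiv_eq ?_
    filter_upwards [hY.eq, hZ.eq] with y h1 h2
    change θ (i y) (push i y (Y' y)) (push i y (Z' y)) = _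
    rw [h1, h2]
    rfl
  rw [covForm] at e ⊢
  rw [e', mvfderiv_comp_apply x (hs.mdifferentiableAt hY.diffAt hZ.diffAt)
    (hi.contMDiff.mdifferentiableAt (by simp))]
  change _ - θ (i x) (push i x (D' Y' x v)) (push i x (Z' x))
    - θ (i x) (push i x (Y' x)) (push i x (D' Z' x v)) = 0
  rw [h.apply hY, h.apply hZ, ← hY.apply, ← hZ.apply, e]

/-- A vector field on `N` is smooth if its image in `M` extends to a smooth vector field. -/
lemma smoothAt_of_push_eq (hi : Manifold.IsImmersion (𝓡 (4 * k)) (𝓡 (4 * n)) ∞ i)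
    (hY : SmoothAt Y (i x)) (h : ∀ᶠ y in 𝓝 x, push i y (Y' y) = Y (i y)) : SmoothAt Y' x := by
  obtain ⟨r, V, hV, hx, hr, hri⟩ := exists_retraction hi x
  refine (pull_smoothAt (hi.contMDiff x) (hr.contMDiffAt (hV.mem_nhds hx)) hri hY).congr ?_
  filter_upwards [h, hri.eventually_nhds,
    hi.contMDiff.continuous.continuousAt (hV.mem_nhds hx)] with y hw h1 h2
  rw [← hw, pull_push (hi.contMDiff y) (hr.contMDiffAt (hV.mem_nhds h2)) h1]

/-- A vector field which is smooth at a point has an extension which is smooth at that point. -/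
lemma SmoothAt.exists_extension (hi : Manifold.IsImmersion (𝓡 (4 * k)) (𝓡 (4 * n)) ∞ i)
    (hY : SmoothAt Y' x) : ∃ Y : VField n M, SmoothAt Y (i x) ∧
      ∀ᶠ y in 𝓝 x, push i y (Y' y) = Y (i y) := by
  obtain ⟨r, V, hV, hx, hr, h⟩ := exists_retraction hi x
  have hrx : r (i x) = x := h.self_of_nhds
  refine ⟨extendAlong i r x Y', extendAlong_smoothAt ⟨mem_chart_source _ _, ?_⟩
    (hi.contMDiff _) (hr.contMDiffAt (hV.mem_nhds hx)) (by rwa [hrx]),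
    extendAlong_eq hi.contMDiff.continuous.continuousAt h Y'⟩
  rw [Set.mem_ofPred, hrx]
  exact mem_chart_source _ _

lemma IsRestriction.contMDiff [T2Space M] (h : IsRestriction i D D')
    (hi : Manifold.IsImmersion (𝓡 (4 * k)) (𝓡 (4 * n)) ∞ i)
    (hD : CovariantDerivative.ContMDiffCovariantDerivative D ∞) :
    CovariantDerivative.ContMDiffCovariantDerivative D' ∞ := by
  refine ⟨⟨fun {σ} hσ x _ ↦ ContMDiffAt.contMDiffWithinAt ?_⟩⟩
  have hσ' (y) : SmoothAt σ y := (hσ y trivial).contMDiffAt Filter.univ_mem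
  obtain ⟨S, hS, e⟩ := exists_smooth_extension (x := x) hi hσ'
  have hDS := (hD.contMDiff.contMDiff (σ := S) fun z _ ↦ (hS z).contMDiffWithinAt) (i x) trivial
  refine contMDiffAt_hom_of_apply fun Y hY ↦ ?_
  obtain ⟨Z, hZ, e'⟩ := hY.exists_extension hi
  refine smoothAt_of_push_eq hi (Y := fun z ↦ D S z (Z z))
    (ContMDiffAt.clm_bundle_apply (hDS.contMDiffAt Filter.univ_mem) hZ) ?_
  filter_upwards [e.eventually_nhds, e'] with y h1 h2
  rw [h.apply ⟨(hσ' y).diffAt, (hS _).diffAt, h1⟩, h2]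

end Induced

/-! ### The restricted structure -/

section Restricted

variable {n k : ℕ} {M : Type*} [TopologicalSpace M]
  [ChartedSpace (EuclideanSpace ℝ (Fin (4 * n))) M] [IsManifold (𝓡 (4 * n)) ∞ M]
  {N : Type*} [TopologicalSpace N]
  [ChartedSpace (EuclideanSpace ℝ (Fin (4 * k))) N] [IsManifold (𝓡 (4 * k)) ∞ N]
  {i : N → M} {Q : EndSubspaceField n M} {θ : FormField n M}

/-- An endomorphism which is the restriction of a smooth one is smooth. -/
lemma SmoothEndOn.restrict (hi : Manifold.IsImmersion (𝓡 (4 * k)) (𝓡 (4 * n)) ∞ i)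
    {σ : EndField n M} {U : Set M} (hU : IsOpen U) (hσ : SmoothEndOn n σ U) {σ' : EndField k N}
    (h : ∀ y, i y ∈ U → ∀ u, push i y (σ' y u) = σ (i y) (push i y u)) :
    SmoothEndOn k σ' (i ⁻¹' U) := by
  intro x hx
  refine (contMDiffAt_hom_of_apply fun Y hY ↦ ?_).contMDiffWithinAt
  obtain ⟨Z, hZ, e⟩ := hY.exists_extension hi
  refine smoothAt_of_push_eq hi (Y := fun z ↦ σ z (Z z))
    (ContMDiffAt.clm_bundle_apply ((hσ (i x) hx).contMDiffAt (hU.mem_nhds hx)) hZ) ?_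
  filter_upwards [e, hi.contMDiff.continuous.continuousAt (hU.mem_nhds hx)] with y h1 h2
  rw [h y h2, h1]

omit [IsManifold (𝓡 (4 * n)) ∞ M] [IsManifold (𝓡 (4 * k)) ∞ N] in
/-- The elements of `Q` restrict to the tangent spaces of `N`. -/
lemma exists_mem_restrictQ (hN : IsAlmostQuaternionicSubmanifold (k := k) Q i) (x : N)
    {q : TangentSpace (𝓡 (4 * n)) (i x) →L[ℝ] TangentSpace (𝓡 (4 * n)) (i x)} (hq : q ∈ Q (i x)) :
    ∃ q' ∈ restrictQ (k := k) Q i x, ∀ u : TangentSpace (𝓡 (4 * k)) x,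
      push i x (q' u) = q (push i x u) := by
  obtain ⟨L, hL⟩ := exists_push_leftInverse hN.1 x
  have h (u : TangentSpace (𝓡 (4 * k)) x) : push i x ((L.comp (q.comp (push i x))) u) = q (push i x u) := by
    obtain ⟨w, hw⟩ := hN.2 x q hq u
    simp only [ContinuousLinearMap.comp_apply]
    rw [hw, hL]
  exact ⟨_, ⟨q, hq, h⟩, h⟩

/-- An admissible basis of `Q` restricts to one of `Q|_{TN}`. -/
lemma IsAdmissibleBasis.exists_restrict (hN : IsAlmostQuaternionicSubmanifold (k := k) Q i)
    {U : Set M} {J : Fin 3 → EndField n M} (hJ : IsAdmissibleBasis n Q U J) :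
    ∃ J' : Fin 3 → EndField k N, IsAdmissibleBasis k (restrictQ Q i) (i ⁻¹' U) J' ∧
      ∀ a y, i y ∈ U → ∀ u, push i y (J' a y u) = J a (i y) (push i y u) := by
  classical
  choose f hfQ hf using fun (a : Fin 3) (y : N) (hy : i y ∈ U) ↦
    exists_mem_restrictQ hN y (hJ.mem hy a)
  let J' : Fin 3 → EndField k N := fun a y ↦ if hy : i y ∈ U then f a y hy else 0
  have h (a y) (hy : i y ∈ U) (u) : push i y (J' a y u) = J a (i y) (push i y u) := by
    simp only [J', dif_pos hy]
    exact hf a y hy u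
  have inj {y : N} {u w : TangentSpace (𝓡 (4 * k)) y} (e : push i y u = push i y w) : u = w :=
    push_injective hN.1 y e
  refine ⟨J', ⟨hJ.isOpen.preimage hN.1.contMDiff.continuous,
    fun a ↦ (hJ.smooth a).restrict hN.1 hJ.isOpen (h a), fun y hy a u ↦ inj ?_,
    fun y hy u ↦ inj ?_, fun y hy u ↦ inj ?_, fun y hy ↦ le_antisymm ?_ ?_⟩, h⟩
  · rw [h a y hy, h a y hy, hJ.sq _ hy, map_neg]
  · rw [h 0 y hy, h 1 y hy, hJ.mul _ hy, h 2 y hy]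
  · rw [h 1 y hy, h 0 y hy, hJ.anti _ hy, map_neg, h 2 y hy]
  · rintro I ⟨q, hq, hI⟩
    obtain ⟨a, b, c, rfl⟩ := hJ.exists_eq hy hq
    rw [Submodule.mem_span_range_iff_exists_fun]
    refine ⟨![a, b, c], ?_⟩
    ext1 u
    refine inj ?_
    rw [hI, Fin.sum_univ_three]
    simp [h _ y hy]
  · rw [Submodule.span_le]
    rintro _ ⟨a, rfl⟩
    exact ⟨J a (i y), hJ.mem hy a, h a y hy⟩

lemma SmoothForm.contMDiffAt {x : M} (hθ : SmoothForm n θ) {X Y : VField n M}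
    (hX : SmoothAt X x) (hY : SmoothAt Y x) :
    ContMDiffAt (𝓡 (4 * n)) 𝓘(ℝ, ℝ) ∞ (fun y ↦ θ y (X y) (Y y)) x := by
  have := ContMDiffAt.clm_bundle_apply₂ (F₃ := ℝ) (E₃ := fun _ ↦ ℝ) (hθ x) hX hY
  rw [Bundle.contMDiffAt_totalSpace] at this
  exact this.2

lemma SmoothForm.pullForm (hi : Manifold.IsImmersion (𝓡 (4 * k)) (𝓡 (4 * n)) ∞ i)
    (hθ : SmoothForm n θ) : SmoothForm k (pullForm θ i : FormField k N) := by
  intro x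
  refine contMDiffAt_hom_of_apply fun Y hY ↦ contMDiffAt_hom_of_apply fun Z hZ ↦ ?_
  obtain ⟨Y₁, hY₁, e⟩ := hY.exists_extension hi
  obtain ⟨Z₁, hZ₁, e'⟩ := hZ.exists_extension hi
  rw [Bundle.contMDiffAt_section]
  refine ((hθ.contMDiffAt hY₁ hZ₁).comp x (hi.contMDiff x)).congr_of_eventuallyEq ?_
  filter_upwards [e, e'] with y h1 h2
  change θ (i y) (push i y (Y y)) (push i y (Z y)) = _
  rw [h1, h2]
  rfl

lemma IsAlmostQSH.restrict (hk : 1 ≤ k) (hN : IsAlmostQuaternionicSubmanifold (k := k) Q i)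
    (h : IsAlmostQSH n Q θ) (hnd : Nondegenerate k (pullForm θ i : FormField k N)) :
    IsAlmostQSH k (restrictQ Q i : EndSubspaceField k N) (pullForm θ i) where
  quaternionic x := by
    obtain ⟨U, J, hx, hJ⟩ := h.quaternionic (i x)
    obtain ⟨J', hJ', -⟩ := hJ.exists_restrict hN
    exact ⟨_, J', hx, hJ'⟩
  smooth := h.smooth.pullForm hN.1
  alternating x u := h.alternating (i x) (push i x u)
  nondegenerate := hnd
  hermitian := by
    intro U' J' hJ' x hx a u w
    obtain ⟨U, J, hxU, hJ⟩ := h.quaternionic (i x)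
    obtain ⟨q, hq, hqJ⟩ := hJ'.mem hx a
    obtain ⟨α, β, γ, rfl⟩ := hJ.exists_eq hxU hq
    have : Nontrivial (TangentSpace (𝓡 (4 * k)) x) :=
      Module.nontrivial_of_finrank_pos (R := ℝ) (by rw [finrank_tangentSpace]; omega)
    obtain ⟨u₀, hu₀⟩ := exists_ne (0 : TangentSpace (𝓡 (4 * k)) x)
    have hp : push i x u₀ ≠ 0 := fun e ↦ hu₀ (push_injective hN.1 x (e.trans (map_zero _).symm))
    have key := (hJ.triple hxU).hermitian (bilin θ (i x)) (fun u w ↦ h.hermitian U J hJ _ hxU 0 u w)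
      (fun u w ↦ h.hermitian U J hJ _ hxU 1 u w) (fun u w ↦ h.hermitian U J hJ _ hxU 2 u w)
      α β γ hp (by
        have := congrArg (push (n := n) i x) (hJ'.sq x hx a u₀)
        rw [hqJ, hqJ, map_neg] at this
        exact this) (push i x u) (push i x w)
    change θ (i x) (push i x (J' a x u)) (push i x (J' a x w)) = _
    rw [hqJ, hqJ]
    exact key

end Restricted

/-! ### The induced connection preserves the restricted quaternionic structure -/

section Trace

variable {n : ℕ} {M : Type*} [TopologicalSpace M]
  [ChartedSpace (EuclideanSpace ℝ (Fin (4 * n))) M] [IsManifold (𝓡 (4 * n)) ∞ M]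
  {σ τ : EndField n M} {U : Set M}

lemma SmoothEndOn.comp (hU : IsOpen U) (hσ : SmoothEndOn n σ U) (hτ : SmoothEndOn n τ U) :
    SmoothEndOn n (fun y ↦ (σ y).comp (τ y)) U := by
  refine fun x hx ↦ (contMDiffAt_hom_of_apply fun Y hY ↦ ?_).contMDiffWithinAt
  have h := ContMDiffAt.clm_bundle_apply ((hσ x hx).contMDiffAt (hU.mem_nhds hx))
    (ContMDiffAt.clm_bundle_apply ((hτ x hx).contMDiffAt (hU.mem_nhds hx)) hY)
  exact h

lemma SmoothEndOn.trace (hU : IsOpen U) (hσ : SmoothEndOn n σ U) :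
    ContMDiffOn (𝓡 (4 * n)) 𝓘(ℝ, ℝ) ∞
      (fun y ↦ LinearMap.trace ℝ (TangentSpace (𝓡 (4 * n)) y) (σ y).toLinearMap) U := by
  intro x hx
  refine ContMDiffAt.contMDiffWithinAt ?_
  set b := (EuclideanSpace.basisFun (Fin (4 * n)) ℝ).toBasis
  set e := trivializationAt (EuclideanSpace ℝ (Fin (4 * n)))
    (TangentSpace (𝓡 (4 * n)) : M → Type _) x
  have hxe : x ∈ e.baseSet := FiberBundle.mem_baseSet_trivializationAt' x
  have hs (j) : SmoothAt (fun y ↦ σ y (e.localFrame b j y)) x :=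
    ContMDiffAt.clm_bundle_apply ((hσ x hx).contMDiffAt (hU.mem_nhds hx))
      (contMDiffAt_localFrame_of_mem ∞ e b j hxe)
  have : ContMDiffAt (𝓡 (4 * n)) 𝓘(ℝ, ℝ) ∞ (fun y ↦ ∑ j,
      e.localFrameCoeff (𝓡 (4 * n)) b j y (σ y (e.localFrame b j y))) x :=
    contMDiffAt_finsetSum fun j _ ↦ contMDiffAt_localFrameCoeff b hxe (hs j) j
  refine this.congr_of_eventuallyEq ?_
  filter_upwards [e.open_baseSet.mem_nhds hxe] with y hy
  rw [LinearMap.trace_eq_matrix_trace ℝ (e.basisAt b hy), Matrix.trace]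
  refine Finset.sum_congr rfl fun j _ ↦ ?_
  rw [Matrix.diag_apply, LinearMap.toMatrix_apply, ← e.localFrame_apply_of_mem_baseSet b hy]
  exact (e.localFrameCoeff_apply_of_mem_baseSet (I := 𝓡 (4 * n)) b hy
    (fun y ↦ σ y (e.localFrame b j y)) j).symm

/-- A smooth section of `Q` is a combination of an admissible basis with smooth coefficients. -/
lemma IsAdmissibleBasis.exists_smooth_coeff (hn : 1 ≤ n) {Q : EndSubspaceField n M}
    {J : Fin 3 → EndField n M} (hJ : IsAdmissibleBasis n Q U J) (hσ : SmoothEndOn n σ U)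
    (hQ : ∀ y ∈ U, σ y ∈ Q y) :
    ∃ c : Fin 3 → M → ℝ, (∀ a, ContMDiffOn (𝓡 (4 * n)) 𝓘(ℝ, ℝ) ∞ (c a) U) ∧
      ∀ y ∈ U, σ y = ∑ a, c a y • J a y := by
  refine ⟨fun a y ↦ -(1 / (4 * n) : ℝ) *
    LinearMap.trace ℝ (TangentSpace (𝓡 (4 * n)) y) ((σ y).comp (J a y)).toLinearMap,
    fun a ↦ contMDiffOn_const.mul ((hσ.comp hJ.isOpen (hJ.smooth a)).trace hJ.isOpen),
    fun y hy ↦ ?_⟩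
  have h := hJ.triple hy
  have hn' : (n : ℝ) ≠ 0 := by positivity
  obtain ⟨α, β, γ, e⟩ := hJ.exists_eq hy (hQ y hy)
  have hd : (Module.finrank ℝ (TangentSpace (𝓡 (4 * n)) y) : ℝ) = 4 * n := by
    rw [finrank_tangentSpace]; push_cast; ring
  have ht (a) : LinearMap.trace ℝ (TangentSpace (𝓡 (4 * n)) y) ((σ y).comp (J a y)).toLinearMap
      = -(4 * n) * ![α, β, γ] a := by
    have e' : ((σ y).comp (J a y)).toLinearMap = (α • (J 0 y).toLinearMap + β • (J 1 y).toLinearMap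
      + γ • (J 2 y).toLinearMap) * (J a y).toLinearMap := by rw [e]; rfl
    rw [e', add_mul, add_mul, smul_mul_assoc, smul_mul_assoc, smul_mul_assoc]
    fin_cases a
    · simp [h.II, h.JI, h.KI, h.trace_J, h.trace_K, hd]; ring
    · simp [h.JJ, h.IJ, h.KJ, h.trace_I, h.trace_K, hd]; ring
    · simp [h.KK, h.IK, h.JK, h.trace_I, h.trace_J, hd]; ring
  have hc (a) : -(1 / (4 * n) : ℝ) * (-(4 * n) * ![α, β, γ] a) = ![α, β, γ] a := by
    field_simp
  simp only [Fin.sum_univ_three]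
  rw [ht 0, ht 1, ht 2, hc 0, hc 1, hc 2]
  exact e

end Trace

section InducedQuaternionic

variable {n k : ℕ} {M : Type*} [TopologicalSpace M]
  [ChartedSpace (EuclideanSpace ℝ (Fin (4 * n))) M] [IsManifold (𝓡 (4 * n)) ∞ M]
  {N : Type*} [TopologicalSpace N]
  [ChartedSpace (EuclideanSpace ℝ (Fin (4 * k))) N] [IsManifold (𝓡 (4 * k)) ∞ N]
  {i : N → M} {Q : EndSubspaceField n M} {D : Conn n M} {D' : Conn k N}

lemma SmoothEndOn.mono {σ : EndField n M} {U V : Set M} (h : SmoothEndOn n σ U) (hVU : V ⊆ U) :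
    SmoothEndOn n σ V := ContMDiffOn.mono h hVU

/-- Every smooth section of `Q|_{TN}` is locally the restriction of a smooth section of `Q`. -/
lemma exists_extension_of_mem_restrictQ (hk : 1 ≤ k) (hQ : IsAlmostQuaternionic n Q)
    (hN : IsAlmostQuaternionicSubmanifold (k := k) Q i) {U : Set N} (hU : IsOpen U)
    {σ : EndField k N} (hσ : SmoothEndOn k σ U) (hσQ : ∀ y ∈ U, σ y ∈ restrictQ Q i y) {x : N}
    (hx : x ∈ U) : ∃ (V : Set M) (τ : EndField n M), IsOpen V ∧ i x ∈ V ∧ SmoothEndOn n τ V ∧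
      (∀ z ∈ V, τ z ∈ Q z) ∧ ∀ᶠ y in 𝓝 x, ∀ u, push i y (σ y u) = τ (i y) (push i y u) := by
  obtain ⟨W, J, hxW, hJ⟩ := hQ (i x)
  obtain ⟨J', hJ', hJJ⟩ := hJ.exists_restrict hN
  have hic := hN.1.contMDiff.continuous
  have hWo : IsOpen (U ∩ i ⁻¹' W) := hU.inter hJ'.isOpen
  have hJU : IsAdmissibleBasis k (restrictQ Q i) (U ∩ i ⁻¹' W) J' :=
    ⟨hWo, fun a ↦ (hJ'.smooth a).mono inter_subset_right, fun y hy ↦ hJ'.sq y hy.2,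
      fun y hy ↦ hJ'.mul y hy.2, fun y hy ↦ hJ'.anti y hy.2, fun y hy ↦ hJ'.span y hy.2⟩
  obtain ⟨c, hc, hσc⟩ := hJU.exists_smooth_coeff hk (hσ.mono inter_subset_left)
    fun y hy ↦ hσQ y hy.1
  obtain ⟨r, R, hR, hxR, hr, hri⟩ := exists_retraction hN.1 x
  have hrx : r (i x) = x := hri.self_of_nhds
  refine ⟨(R ∩ r ⁻¹' (U ∩ i ⁻¹' W)) ∩ W, fun z ↦ ∑ a, c a (r z) • J a z,
    (hr.continuousOn.isOpen_inter_preimage hR hWo).inter hJ.isOpen,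
    ⟨⟨hxR, by rw [mem_preimage, hrx]; exact ⟨hx, hxW⟩⟩, hxW⟩, fun z hz ↦ ?_, fun z hz ↦ ?_, ?_⟩
  · refine ContMDiffAt.contMDiffWithinAt (ContMDiffAt.sum_section fun a _ ↦ ?_)
    exact ContMDiffAt.smul_section
      (((hc a).contMDiffAt (hWo.mem_nhds hz.1.2)).comp z (hr.contMDiffAt (hR.mem_nhds hz.1.1)))
      ((hJ.smooth a z hz.2).contMDiffAt (hJ.isOpen.mem_nhds hz.2))
  · exact Submodule.sum_mem _ fun a _ ↦ Submodule.smul_mem _ _ (hJ.mem hz.2 a)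
  · filter_upwards [hri, hWo.mem_nhds ⟨hx, hxW⟩] with y h1 h2 u
    simp only [h1, hσc y h2, sum_apply, smul_apply, map_sum, map_smul, hJJ _ y h2.2]

lemma IsRestriction.preservesQ (hk : 1 ≤ k) (h : IsRestriction i D D')
    (hQ : IsAlmostQuaternionic n Q) (hN : IsAlmostQuaternionicSubmanifold (k := k) Q i)
    (hD : PreservesQ n D Q) : PreservesQ k D' (restrictQ Q i) := by
  intro U σ hU hσ hσQ x hx v
  obtain ⟨V, τ, hV, hxV, hτ, hτQ, e⟩ := exists_extension_of_mem_restrictQ hk hQ hN hU hσ hσQ hx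
  obtain ⟨q, hq, hqD⟩ := hD V τ hV hτ hτQ (i x) hxV (push i x v)
  obtain ⟨q', hq', hqq⟩ := exists_mem_restrictQ hN x hq
  refine ⟨q', hq', fun Y' hY' ↦ push_injective hN.1 x ?_⟩
  obtain ⟨Y, hY⟩ := exists_extends hN.1 hY'
  have hE : Extends i x (fun y ↦ σ y (Y' y)) (fun z ↦ τ z (Y z)) :=
    ⟨hσ.diffAt hU hx hY', hτ.diffAt hV hxV hY.diffAt, by
      filter_upwards [e, hY.eq] with y h1 h2; rw [h1, h2]⟩
  rw [map_sub, h.apply hE, e.self_of_nhds, h.apply hY, hqq, ← hY.apply]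
  exact hqD Y hY.diffAt

end InducedQuaternionic

end QSH

end

theorem theorem3p32 (n k : ℕ) (hk : 1 ≤ k) (hkn : k < n)
    {M : Type*} [TopologicalSpace M] [T2Space M] [SecondCountableTopology M]
    [ChartedSpace (EuclideanSpace ℝ (Fin (4 * n))) M] [IsManifold (𝓡 (4 * n)) ∞ M]
    {N : Type*} [TopologicalSpace N] [T2Space N] [SecondCountableTopology N]
    [ChartedSpace (EuclideanSpace ℝ (Fin (4 * k))) N] [IsManifold (𝓡 (4 * k)) ∞ N]
    (Q : QSH.EndSubspaceField n M) (θ : QSH.FormField n M) (hM : QSH.IsQSH n Q θ)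
    (i : N → M) (hN : QSH.IsAlmostQuaternionicSubmanifold (k := k) Q i)
    (hnd : QSH.Nondegenerate k (QSH.pullForm θ i : QSH.FormField k N)) :
    QSH.IsQSH k (QSH.restrictQ Q i : QSH.EndSubspaceField k N) (QSH.pullForm θ i) ∧
    QSH.IsClosedForm k (QSH.pullForm θ i : QSH.FormField k N) ∧
    ∃ (DM DMvol : QSH.Conn n M) (DN : QSH.Conn k N),
      QSH.IsTheConn n (QSH.IsMinimalAdapted n Q θ) DM ∧
      QSH.IsTheConn n (QSH.IsOproiu n Q (QSH.vol n θ)) DMvol ∧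
      QSH.IsTheConn k (QSH.IsMinimalAdapted k (QSH.restrictQ Q i) (QSH.pullForm θ i)) DN ∧
      DM.torsion = 0 ∧ DN.torsion = 0 ∧
      QSH.IsRestriction i DM DN ∧ QSH.IsRestriction i DMvol DN := by
  obtain ⟨hS, D, hsm, hDQ, hDθ, hD⟩ := hM
  obtain ⟨D', hr⟩ := QSH.exists_isRestriction (D := D) hN.1 fun x Y' Y h v ↦
    h.exists_conn_eq hN hS.quaternionic hDQ hD v
  have hS' := hS.restrict hk hN hnd
  have hsm' := hr.contMDiff hN.1 hsm
  have hDQ' := hr.preservesQ hk hS.quaternionic hN hDQ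
  have hDθ' := hr.preservesForm hN.1 hS.smooth hDθ
  have hD' := hr.torsion_eq_zero hN.1 hD
  have hn : 1 ≤ n := hk.trans hkn.le
  exact ⟨⟨hS', D', hsm', hDQ', hDθ', hD'⟩, hDθ'.isClosedForm hD' hS'.alternating, D, D, D',
    QSH.isTheConn_isMinimalAdapted hn hS hsm hDQ hDθ hD,
    QSH.isTheConn_isOproiu hn hS hsm hDQ hDθ hD,
    QSH.isTheConn_isMinimalAdapted hk hS' hsm' hDQ' hDθ' hD', hD, hD', hr, hr⟩
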